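/- Let $s\ge 2$ be an integer and put $\lambda_s=\dfrac{\Gamma(1/s)^s}{s^s\,s!}$. Let $A$ be a random sequence of pseudo $s$-th powers, that is, a random set of positive integers, defined on a probability space, such that the events $\{n\in A\}$, $n\ge 1$, are mutually independent and $\mathbb P(n\in A)=\frac1s\,n^{-1+1/s}$ for every $n\ge1$. Let $B$ be a fixed (deterministic) set of non-negative integers, with counting function $B(n)=|B\cap[1,n]|$, satisfying $$\liminf_{n\to\infty}\frac{B(n)}{\log n}<\frac1{\lambda_s}.$$ Then, almost surely, there are infinitely many positive integers $n$ that cannot be written in the form $$n=a_1+\cdots+a_s+b\qquad\text{with pairwise distinct } a_1,\dots,a_s\in A \text{ and with } b\in B.$$ -/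

import Mathlib

open Filter MeasureTheory ProbabilityTheory

/-- The constant `λ_s = Γ(1/s)^s / (s^s * s!)`. -/
noncomputable def lambdaConst (s : ℕ) : ℝ :=
  Real.Gamma (1 / (s : ℝ)) ^ s / ((s : ℝ) ^ s * (Nat.factorial s : ℝ))

/-- `A` is a random sequence of pseudo `s`-th powers on the probability space `(Ω, P)`: a random set
of positive integers such that the events `{n ∈ A}` are mutually independent and
`P (n ∈ A) = n ^ (-1 + 1/s) / s` for all `n ≥ 1`. -/
structure IsPseudoPowers {Ω : Type*} [MeasurableSpace Ω] (P : Measure Ω) (s : ℕ)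
    (A : Ω → Set ℕ) : Prop where
  zero_notMem : ∀ ω, 0 ∉ A ω
  measurableSet_mem : ∀ n : ℕ, MeasurableSet {ω | n ∈ A ω}
  indep : iIndepSet (fun n : ℕ => {ω | n ∈ A ω}) P
  prob : ∀ n : ℕ, 1 ≤ n →
    P {ω | n ∈ A ω} = ENNReal.ofReal ((n : ℝ) ^ (-1 + 1 / (s : ℝ)) / (s : ℝ))

/-- The counting function `B(n) = |B ∩ [1, n]|`. -/
noncomputable def countFn (B : Set ℕ) (n : ℕ) : ℕ := (B ∩ Set.Icc 1 n).ncard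

/-- `n = a_1 + ⋯ + a_s + b` with pairwise distinct `a_i ∈ A` and with `b ∈ B`. -/
def IsDistinctSumAdd (s : ℕ) (A B : Set ℕ) (n : ℕ) : Prop :=
  ∃ a : Fin s → ℕ, Function.Injective a ∧ (∀ i, a i ∈ A) ∧ ∃ b ∈ B, n = (∑ i, a i) + b

/-! Let `c` satisfy `c * λ_s < 1`, and let `N` range over the infinitely many integers with `B(N) ≤
c log N`. An integer `n ≤ N` is unrepresented exactly when `A` contains no `s`-set `S` for which `n
- ∑ S` lies in `B`. For each `b` the expected number of `s`-sets in `A` with sum `n - b` is at most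
`λ_s`. This holds with no error term, because the density is dominated by a shifted binomial series
whose `s`-th power is a geometric series (`powerDensity_succ_le`,
`repSum_powerDensity_le_lambdaConst`). So the expected number of representations is at most about `c
λ_s log N`, and positive correlation gives `n` a chance of at least roughly `N ^ (-c λ_s)` of being
missed (`exp_le_measure_avoidsEvent`). As `c λ_s < 1`, the expected number of missed integers up to
`N` tends to infinity.

The second moment method turns this into existence (`measure_compl_biUnion_le`). Janson's inequality
(`measure_avoidsEvent_le_exp`) shows that missing `n` and missing `m` are almost uncorrelated, since
overlapping pairs of representing sets carry a weight that is a negative power of `N`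
(`overlapSum_powerDensity_le`). Two kinds of exception are discarded: integers just above an element
of `B`, whose representing sets may have small sums, and pairs with `n - m` in `B - B`, whose
families may share sets. Both are few because `B` has only `O(log N)` elements up to `N`. Letting
`N` grow, for each `M` the event that everything above `M` is represented is null. -/

/-- The event that the random set `A` contains the finite set `S`. -/
def containsEvent {Ω : Type*} (A : Ω → Set ℕ) (S : Finset ℕ) : Set Ω := {ω | ∀ i ∈ S, i ∈ A ω}

/-- The event that the random set `A` contains no member of the finite family `F`. -/
def avoidsEvent {Ω : Type*} (A : Ω → Set ℕ) (F : Finset (Finset ℕ)) : Set Ω :=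
  {ω | ∀ S ∈ F, ¬ ∀ i ∈ S, i ∈ A ω}

/-! ### Positive correlation and Janson's inequality for avoidance events. -/

section Avoids

variable {Ω : Type*} {A : Ω → Set ℕ}

lemma containsEvent_eq_biInter (S : Finset ℕ) :
    containsEvent A S = ⋂ i ∈ S, {ω | i ∈ A ω} := by
  ext ω; simp [containsEvent]

lemma avoidsEvent_eq_biInter (F : Finset (Finset ℕ)) :
    avoidsEvent A F = ⋂ S ∈ F, (containsEvent A S)ᶜ := by
  ext ω; simp [containsEvent, avoidsEvent]

lemma avoidsEvent_empty : avoidsEvent A ∅ = Set.univ := by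
  ext ω; simp [avoidsEvent]

lemma avoidsEvent_insert [DecidableEq (Finset ℕ)] (S : Finset ℕ) (F : Finset (Finset ℕ)) :
    avoidsEvent A (insert S F) = avoidsEvent A F \ (containsEvent A S ∩ avoidsEvent A F) := by
  ext ω
  simp only [avoidsEvent, containsEvent, Finset.mem_insert, forall_eq_or_imp, Set.mem_ofPred_eq,
    Set.mem_sdiff, Set.mem_inter_iff]
  tauto

lemma avoidsEvent_union [DecidableEq (Finset ℕ)] (F G : Finset (Finset ℕ)) :
    avoidsEvent A (F ∪ G) = avoidsEvent A F ∩ avoidsEvent A G := by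
  ext ω
  simp only [avoidsEvent, Finset.mem_union, Set.mem_ofPred_eq, Set.mem_inter_iff]
  exact ⟨fun h => ⟨fun S hS => h S (Or.inl hS), fun S hS => h S (Or.inr hS)⟩,
    fun h S hS => hS.elim (h.1 S) (h.2 S)⟩

lemma avoidsEvent_anti {F G : Finset (Finset ℕ)} (h : F ⊆ G) :
    avoidsEvent A G ⊆ avoidsEvent A F := fun _ hω S hS => hω S (h hS)

lemma measurableSet_containsEvent_iSup {I : Set ℕ} {S : Finset ℕ} (hS : ↑S ⊆ I) :
    MeasurableSet[⨆ i ∈ I, MeasurableSpace.generateFrom {{ω | i ∈ A ω}}]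
      (containsEvent A S) := by
  rw [containsEvent_eq_biInter]
  refine Finset.measurableSet_biInter _ fun i hi => ?_
  have : MeasurableSpace.generateFrom {{ω | i ∈ A ω}} ≤
      ⨆ i ∈ I, MeasurableSpace.generateFrom {{ω | i ∈ A ω}} :=
    le_iSup₂ (f := fun i (_ : i ∈ I) => MeasurableSpace.generateFrom {{ω | i ∈ A ω}}) i (hS hi)
  exact this _ (MeasurableSpace.measurableSet_generateFrom rfl)

variable [MeasurableSpace Ω] {P : Measure Ω}

lemma measurableSet_containsEvent (hm : ∀ n, MeasurableSet {ω | n ∈ A ω}) (S : Finset ℕ) :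
    MeasurableSet (containsEvent A S) := by
  rw [containsEvent_eq_biInter]
  exact Finset.measurableSet_biInter _ fun i _ => hm i

lemma measurableSet_avoidsEvent (hm : ∀ n, MeasurableSet {ω | n ∈ A ω})
    (F : Finset (Finset ℕ)) : MeasurableSet (avoidsEvent A F) := by
  rw [avoidsEvent_eq_biInter]
  exact Finset.measurableSet_biInter _ fun S _ => (measurableSet_containsEvent hm S).compl

lemma measure_containsEvent (hi : iIndepSet (fun n : ℕ => {ω | n ∈ A ω}) P) (S : Finset ℕ) :
    P.real (containsEvent A S) = ∏ i ∈ S, P.real {ω | i ∈ A ω} := by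
  rw [containsEvent_eq_biInter, measureReal_def, hi.meas_biInter, ENNReal.toReal_prod]
  rfl

/-- The two events are measurable for the σ-algebras generated by the indices in `S` and outside
`S`, which are independent. -/
lemma measure_containsEvent_inter_avoidsEvent_of_disjoint
    (hm : ∀ n, MeasurableSet {ω | n ∈ A ω})
    (hi : iIndepSet (fun n : ℕ => {ω | n ∈ A ω}) P) (S : Finset ℕ) (F : Finset (Finset ℕ))
    (hF : ∀ T ∈ F, Disjoint T S) :
    P.real (containsEvent A S ∩ avoidsEvent A F) =
      (∏ i ∈ S, P.real {ω | i ∈ A ω}) * P.real (avoidsEvent A F) := by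
  have hind := indep_iSup_of_disjoint (m := fun i => MeasurableSpace.generateFrom {{ω | i ∈ A ω}})
    (μ := P) (S := (S : Set ℕ)) (T := (S : Set ℕ)ᶜ)
    (fun i => MeasurableSpace.generateFrom_le (by rintro t rfl; exact hm i)) hi
    disjoint_compl_right
  rw [← measure_containsEvent hi, measureReal_def, measureReal_def, measureReal_def,
    ← ENNReal.toReal_mul]
  congr 1
  refine (Indep_iff _ _ P).1 hind _ _ (measurableSet_containsEvent_iSup subset_rfl) ?_
  rw [avoidsEvent_eq_biInter]
  refine Finset.measurableSet_biInter _ fun T hT => ?_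
  refine MeasurableSet.compl ?_
  refine measurableSet_containsEvent_iSup fun i hi hi' => ?_
  exact Finset.disjoint_left.1 (hF T hT) hi hi'

variable [IsProbabilityMeasure P]

/-- Conditioning on the presence of a set makes avoiding a family less likely. -/
lemma measure_containsEvent_inter_avoidsEvent_le
    (hm : ∀ n, MeasurableSet {ω | n ∈ A ω})
    (hi : iIndepSet (fun n : ℕ => {ω | n ∈ A ω}) P) (S : Finset ℕ) (F : Finset (Finset ℕ)) :
    P.real (containsEvent A S ∩ avoidsEvent A F) ≤
      (∏ i ∈ S, P.real {ω | i ∈ A ω}) * P.real (avoidsEvent A F) := by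
  classical
  -- Once `S ⊆ A`, avoiding `T` is the same as avoiding `T \ S`. The reduced sets are disjoint from
  -- `S`, so independence applies, and avoiding them is a smaller event than avoiding the original
  -- sets.
  have h1 : containsEvent A S ∩ avoidsEvent A F ⊆
      containsEvent A S ∩ avoidsEvent A (F.image (· \ S)) := by
    rintro ω ⟨h, h'⟩
    refine ⟨h, fun T hT hTA => ?_⟩
    obtain ⟨T, hT', rfl⟩ := Finset.mem_image.1 hT
    refine h' T hT' fun i hi => ?_
    by_cases hiS : i ∈ S
    · exact h i hiS
    · exact hTA i (Finset.mem_sdiff.2 ⟨hi, hiS⟩)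
  have h2 : avoidsEvent A (F.image (· \ S)) ⊆ avoidsEvent A F := fun ω h T hT hTA =>
    h (T \ S) (Finset.mem_image_of_mem _ hT) fun i hi => hTA i (Finset.mem_sdiff.1 hi).1
  refine (measureReal_mono h1).trans ?_
  rw [measure_containsEvent_inter_avoidsEvent_of_disjoint hm hi]
  · exact mul_le_mul_of_nonneg_left (measureReal_mono h2)
      (Finset.prod_nonneg fun _ _ => measureReal_nonneg)
  · intro T hT
    obtain ⟨T, -, rfl⟩ := Finset.mem_image.1 hT
    exact Finset.sdiff_disjoint

lemma measure_avoidsEvent_insert [DecidableEq (Finset ℕ)]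
    (hm : ∀ n, MeasurableSet {ω | n ∈ A ω}) (S : Finset ℕ) (F : Finset (Finset ℕ)) :
    P.real (avoidsEvent A (insert S F)) =
      P.real (avoidsEvent A F) - P.real (containsEvent A S ∩ avoidsEvent A F) := by
  rw [avoidsEvent_insert, measureReal_sdiff Set.inter_subset_right
    ((measurableSet_containsEvent hm S).inter (measurableSet_avoidsEvent hm F))]

/-- A Harris-type bound: by negative correlation with `containsEvent A S`, each further set `S`
costs at most a factor one minus its weight. -/
lemma prod_le_measure_avoidsEvent
    (hm : ∀ n, MeasurableSet {ω | n ∈ A ω})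
    (hi : iIndepSet (fun n : ℕ => {ω | n ∈ A ω}) P) (F : Finset (Finset ℕ)) :
    ∏ S ∈ F, (1 - ∏ i ∈ S, P.real {ω | i ∈ A ω}) ≤ P.real (avoidsEvent A F) := by
  classical
  induction F using Finset.induction_on with
  | empty => simp [avoidsEvent_empty]
  | insert S F hS ih =>
    rw [Finset.prod_insert hS, measure_avoidsEvent_insert hm]
    have h1 := measure_containsEvent_inter_avoidsEvent_le hm hi S F
    have h2 : ∏ i ∈ S, P.real {ω | i ∈ A ω} ≤ 1 :=
      Finset.prod_le_one (fun _ _ => measureReal_nonneg) fun _ _ => measureReal_le_one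
    nlinarith

/-- **Janson's inequality** for families of sets of independent points. -/
lemma measure_avoidsEvent_le_exp
    (hm : ∀ n, MeasurableSet {ω | n ∈ A ω})
    (hi : iIndepSet (fun n : ℕ => {ω | n ∈ A ω}) P) (F : Finset (Finset ℕ)) :
    P.real (avoidsEvent A F) ≤ Real.exp (- ∑ S ∈ F, ∏ i ∈ S, P.real {ω | i ∈ A ω} +
      ∑ q ∈ (F ×ˢ F).filter (fun q => q.1 ≠ q.2 ∧ ¬ Disjoint q.1 q.2),
        ∏ i ∈ q.1 ∪ q.2, P.real {ω | i ∈ A ω}) := by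
  classical
  set w : Finset ℕ → ℝ := fun S => ∏ i ∈ S, P.real {ω | i ∈ A ω} with hw
  have hw0 : ∀ S, 0 ≤ w S := fun S => Finset.prod_nonneg fun _ _ => measureReal_nonneg
  have hw1 : ∀ S, w S = P.real (containsEvent A S) := fun S => (measure_containsEvent hi S).symm
  change P.real (avoidsEvent A F) ≤ Real.exp (- ∑ S ∈ F, w S +
      ∑ q ∈ (F ×ˢ F).filter (fun q => q.1 ≠ q.2 ∧ ¬ Disjoint q.1 q.2), w (q.1 ∪ q.2))
  induction F using Finset.induction_on with
  | empty => simp [avoidsEvent_empty]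
  | insert S F hS ih =>
    set d : ℝ := ∑ T ∈ F.filter (fun T => ¬ Disjoint S T), w (S ∪ T) with hd
    have key : P.real (avoidsEvent A (insert S F)) ≤
        (1 - w S + d) * P.real (avoidsEvent A F) := by
      -- `C` collects the sets that do not interact with `S`. If `S` is present and `C` is avoided,
      -- then either all of `F` is avoided or some `T` meeting `S` is present; the latter costs at
      -- most `d` by the union bound.
      set C := F.filter (fun T => Disjoint T S) with hC
      have h1 : P.real (containsEvent A S ∩ avoidsEvent A C) = w S * P.real (avoidsEvent A C) :=
        measure_containsEvent_inter_avoidsEvent_of_disjoint hm hi S C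
          fun T hT => (Finset.mem_filter.1 hT).2
      have h2 : containsEvent A S ∩ avoidsEvent A C ⊆ (containsEvent A S ∩ avoidsEvent A F) ∪
          ⋃ T ∈ F.filter (fun T => ¬ Disjoint S T),
            (containsEvent A (S ∪ T) ∩ avoidsEvent A C) := by
        rintro ω ⟨h, h'⟩
        by_cases hωF : ω ∈ avoidsEvent A F
        · exact Or.inl ⟨h, hωF⟩
        · right
          obtain ⟨T, hT, hTA⟩ : ∃ T ∈ F, ∀ i ∈ T, i ∈ A ω := by
            by_contra h''
            exact hωF fun T hT hTA => h'' ⟨T, hT, hTA⟩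
          have hST : ¬ Disjoint S T := fun hST =>
            h' T (Finset.mem_filter.2 ⟨hT, hST.symm⟩) hTA
          refine Set.mem_biUnion (x := T) (Finset.mem_coe.2 (Finset.mem_filter.2 ⟨hT, hST⟩))
            ⟨fun i hi => ?_, h'⟩
          rcases Finset.mem_union.1 hi with hi | hi
          exacts [h i hi, hTA i hi]
      have h3 : P.real (⋃ T ∈ F.filter (fun T => ¬ Disjoint S T),
            (containsEvent A (S ∪ T) ∩ avoidsEvent A C)) ≤ d * P.real (avoidsEvent A C) := by
        refine (measureReal_biUnion_finset_le _ _).trans ?_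
        rw [hd, Finset.sum_mul]
        exact Finset.sum_le_sum fun T _ => measure_containsEvent_inter_avoidsEvent_le hm hi _ _
      have h4 := (measureReal_mono (μ := P) h2).trans (measureReal_union_le _ _)
      have h5 : (w S - d) * P.real (avoidsEvent A C) ≤
          P.real (containsEvent A S ∩ avoidsEvent A F) := by linarith
      have h6 : P.real (avoidsEvent A F) ≤ P.real (avoidsEvent A C) :=
        measureReal_mono (avoidsEvent_anti (Finset.filter_subset _ _))
      have h7 : (w S - d) * P.real (avoidsEvent A F) ≤
          P.real (containsEvent A S ∩ avoidsEvent A F) := by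
        rcases le_total 0 (w S - d) with h | h
        · exact (mul_le_mul_of_nonneg_left h6 h).trans h5
        · exact (mul_nonpos_of_nonpos_of_nonneg h measureReal_nonneg).trans measureReal_nonneg
      rw [measure_avoidsEvent_insert hm]
      linarith
    -- Only the ordered pairs `(S, T)` are needed to pay for `d`; the pairs `(T, S)` are wasted,
    -- which costs a harmless factor 2 in the overlap term.
    have hsub : d + ∑ q ∈ (F ×ˢ F).filter (fun q => q.1 ≠ q.2 ∧ ¬ Disjoint q.1 q.2),
        w (q.1 ∪ q.2) ≤ ∑ q ∈ (insert S F ×ˢ insert S F).filter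
          (fun q => q.1 ≠ q.2 ∧ ¬ Disjoint q.1 q.2), w (q.1 ∪ q.2) := by
      have hd' : d = ∑ q ∈ (F.filter (fun T => ¬ Disjoint S T)).image (fun T => (S, T)),
          w (q.1 ∪ q.2) := by
        rw [Finset.sum_image]
        intro a _ b _ h
        exact (Prod.mk.inj h).2
      rw [hd', ← Finset.sum_union]
      · refine Finset.sum_le_sum_of_subset_of_nonneg ?_ fun _ _ _ => hw0 _
        intro q hq
        simp only [Finset.mem_union, Finset.mem_image, Finset.mem_filter, Finset.mem_product,
          Finset.mem_insert] at hq ⊢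
        rcases hq with ⟨T, ⟨hT, hST⟩, rfl⟩ | ⟨⟨h1, h2⟩, h3⟩
        · exact ⟨⟨Or.inl rfl, Or.inr hT⟩, fun h => hS (by rw [show S = T from h]; exact hT), hST⟩
        · exact ⟨⟨Or.inr h1, Or.inr h2⟩, h3⟩
      · rw [Finset.disjoint_left]
        intro q hq hq'
        obtain ⟨T, -, rfl⟩ := Finset.mem_image.1 hq
        exact hS (Finset.mem_product.1 (Finset.mem_filter.1 hq').1).1
    rw [Finset.sum_insert hS]
    have h8 : 1 - w S + d ≤ Real.exp (-w S + d) := by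
      have := Real.add_one_le_exp (-w S + d); linarith
    calc _ ≤ (1 - w S + d) * P.real (avoidsEvent A F) := key
      _ ≤ Real.exp (-w S + d) * P.real (avoidsEvent A F) :=
        mul_le_mul_of_nonneg_right h8 measureReal_nonneg
      _ ≤ Real.exp (-w S + d) * _ := mul_le_mul_of_nonneg_left ih (Real.exp_pos _).le
      _ ≤ _ := by
        rw [← Real.exp_add]
        exact Real.exp_le_exp.2 (by linarith)

end Avoids

/-! ### Generating functions: domination of the density by a binomial series. -/

/-- The density `n ^ (-1 + 1/s) / s` of the pseudo `s`-th powers. -/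
noncomputable def powerDensity (s n : ℕ) : ℝ := (n : ℝ) ^ (-1 + 1 / (s : ℝ)) / (s : ℝ)

/-- The coefficients of `(1 - x) ^ (-α)`. -/
noncomputable def negBinomCoeff (α : ℝ) (n : ℕ) : ℝ :=
  Real.Gamma (n + α) / (Real.Gamma α * n.factorial)

lemma powerDensity_nonneg (s n : ℕ) : 0 ≤ powerDensity s n := by
  unfold powerDensity; positivity

lemma powerDensity_zero {s : ℕ} (hs : 2 ≤ s) : powerDensity s 0 = 0 := by
  have h1 : (1 : ℝ) / s < 1 := by
    rw [div_lt_one (by positivity)]; exact_mod_cast hs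
  unfold powerDensity
  rw [Nat.cast_zero, Real.zero_rpow (by linarith), zero_div]

lemma powerDensity_le {s n : ℕ} (hs : 2 ≤ s) (hn : 1 ≤ n) :
    powerDensity s n ≤ (n : ℝ) ^ (-(1 / (s : ℝ))) := by
  have hs' : (2 : ℝ) ≤ s := by exact_mod_cast hs
  have hn' : (1 : ℝ) ≤ n := by exact_mod_cast hn
  have h1 : (1 : ℝ) / s ≤ 1 / 2 := one_div_le_one_div_of_le (by norm_num) hs'
  unfold powerDensity
  refine (div_le_self (by positivity) (by linarith)).trans ?_
  exact Real.rpow_le_rpow_of_exponent_le hn' (by linarith)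

/-- Log-convexity of `Γ` between `n + α` and `n + α + 1` gives `n! ≤ (n + α) ^ (1 - α) Γ(n + α)`.
The shift of index makes the domination hold termwise, not just asymptotically. -/
lemma powerDensity_succ_le {s : ℕ} (hs : 2 ≤ s) (n : ℕ) :
    powerDensity s (n + 1) ≤ Real.Gamma (1 / (s : ℝ)) / s * negBinomCoeff (1 / (s : ℝ)) n := by
  have hs' : (2 : ℝ) ≤ s := by exact_mod_cast hs
  have hα0 : (0 : ℝ) < 1 / s := by positivity
  have hα1 : (1 : ℝ) / s < 1 := by rw [div_lt_one (by linarith)]; linarith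
  unfold powerDensity negBinomCoeff
  set α : ℝ := 1 / s
  have hn0 : (0 : ℝ) ≤ n := n.cast_nonneg
  have hG : 0 < Real.Gamma α := Real.Gamma_pos_of_pos hα0
  have hGn : 0 < Real.Gamma (n + α) := Real.Gamma_pos_of_pos (by linarith)
  have hcv := Real.Gamma_mul_add_mul_le_rpow_Gamma_mul_rpow_Gamma (s := n + α) (t := n + α + 1)
    (a := α) (b := 1 - α) (by linarith) (by linarith) hα0 (by linarith) (by ring)
  rw [show α * (n + α) + (1 - α) * (n + α + 1) = n + 1 by ring, Real.Gamma_nat_eq_factorial,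
    Real.Gamma_add_one (by linarith), Real.mul_rpow (by linarith) hGn.le,
    mul_left_comm, ← Real.rpow_add hGn, add_sub_cancel, Real.rpow_one] at hcv
  have h2 : ((n : ℝ) + α) ^ (1 - α) ≤ ((n : ℝ) + 1) ^ (1 - α) :=
    Real.rpow_le_rpow (by linarith) (by linarith) (by linarith)
  have h3 : (n.factorial : ℝ) ≤ ((n : ℝ) + 1) ^ (1 - α) * Real.Gamma (n + α) :=
    hcv.trans (mul_le_mul_of_nonneg_right h2 hGn.le)
  have hf : (0 : ℝ) < n.factorial := by exact_mod_cast n.factorial_pos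
  have h4 : ((n : ℝ) + 1) ^ (-1 + α) * ((n : ℝ) + 1) ^ (1 - α) = 1 := by
    rw [← Real.rpow_add (by linarith)]; simp
  have h5 : ((n : ℝ) + 1) ^ (-1 + α) ≤ Real.Gamma (n + α) / n.factorial := by
    rw [le_div_iff₀ hf]
    calc _ ≤ ((n : ℝ) + 1) ^ (-1 + α) * (((n : ℝ) + 1) ^ (1 - α) * Real.Gamma (n + α)) :=
          mul_le_mul_of_nonneg_left h3 (by positivity)
      _ = _ := by rw [← mul_assoc, h4, one_mul]
  push_cast
  rw [show Real.Gamma α / s * (Real.Gamma (n + α) / (Real.Gamma α * n.factorial)) =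
    Real.Gamma (n + α) / n.factorial / s by field_simp]
  gcongr

lemma negBinomCoeff_zero {α : ℝ} (hα : 0 < α) : negBinomCoeff α 0 = 1 := by
  have := (Real.Gamma_pos_of_pos hα).ne'
  simp [negBinomCoeff, this]

lemma negBinomCoeff_succ {α : ℝ} (hα : 0 < α) (n : ℕ) :
    negBinomCoeff α (n + 1) * (n + 1) = (n + α) * negBinomCoeff α n := by
  have := (Real.Gamma_pos_of_pos hα).ne'
  have hn : (0 : ℝ) < n + α := by positivity
  have hf : (n.factorial : ℝ) ≠ 0 := by exact_mod_cast n.factorial_ne_zero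
  unfold negBinomCoeff
  push_cast [Nat.factorial_succ]
  rw [show (n : ℝ) + 1 + α = (n + α) + 1 by ring, Real.Gamma_add_one hn.ne']
  field_simp

namespace PowerSeries

lemma coeff_mul_le {f g f' g' : ℝ⟦X⟧} (hf : ∀ n, 0 ≤ coeff n f) (hg' : ∀ n, 0 ≤ coeff n g')
    (hff : ∀ n, coeff n f ≤ coeff n f') (hgg : ∀ n, coeff n g ≤ coeff n g')
    (n : ℕ) : coeff n (f * g) ≤ coeff n (f' * g') := by
  rw [coeff_mul, coeff_mul]
  exact Finset.sum_le_sum fun q _ => (mul_le_mul_of_nonneg_left (hgg _) (hf _)).trans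
    (mul_le_mul_of_nonneg_right (hff _) (hg' _))

lemma coeff_mul_nonneg {f g : ℝ⟦X⟧} (hf : ∀ n, 0 ≤ coeff n f) (hg : ∀ n, 0 ≤ coeff n g)
    (n : ℕ) : 0 ≤ coeff n (f * g) := by
  rw [coeff_mul]
  exact Finset.sum_nonneg fun q _ => mul_nonneg (hf _) (hg _)

lemma coeff_pow_nonneg {f : ℝ⟦X⟧} (hf : ∀ n, 0 ≤ coeff n f) (j n : ℕ) :
    0 ≤ coeff n (f ^ j) := by
  induction j generalizing n with
  | zero => rw [pow_zero, coeff_one]; split_ifs <;> norm_num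
  | succ j ih => rw [pow_succ]; exact coeff_mul_nonneg ih hf n

lemma coeff_pow_le {f g : ℝ⟦X⟧} (hf : ∀ n, 0 ≤ coeff n f)
    (hfg : ∀ n, coeff n f ≤ coeff n g) (j n : ℕ) : coeff n (f ^ j) ≤ coeff n (g ^ j) := by
  induction j generalizing n with
  | zero => simp
  | succ j ih =>
    rw [pow_succ, pow_succ]
    exact coeff_mul_le (coeff_pow_nonneg hf j) (fun n => (hf n).trans (hfg n)) ih hfg n

/-- The recursion for the coefficients of the powers of a solution of `(1 - X) F' = α F`. -/
lemma coeff_succ_pow_of_coeff_succ {F : ℝ⟦X⟧} {α : ℝ}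
    (hF : ∀ n : ℕ, coeff (n + 1) F * (n + 1) = (n + α) * coeff n F) (j n : ℕ) :
    coeff (n + 1) (F ^ j) * (n + 1) = (n + j * α) * coeff n (F ^ j) := by
  have h1 : (1 - X) * derivative ℝ F = C α * F := by
    ext n
    rw [sub_mul, one_mul, map_sub, coeff_derivative, hF, coeff_C_mul]
    cases n with
    | zero => simp
    | succ n => rw [coeff_succ_X_mul, coeff_derivative]; push_cast; ring
  have h2 : (1 - X) * derivative ℝ (F ^ j) = C (j * α) * F ^ j := by
    rw [Derivation.leibniz_pow]
    cases j with
    | zero => simp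
    | succ j =>
      simp only [smul_eq_mul, nsmul_eq_mul, Nat.add_sub_cancel, map_mul, pow_succ]
      have : (C ((j + 1 : ℕ) : ℝ) : ℝ⟦X⟧) = ((j + 1 : ℕ) : ℝ⟦X⟧) := map_natCast C _
      rw [this]
      linear_combination ((j + 1 : ℕ) : ℝ⟦X⟧) * F ^ j * h1
  have h3 := congrArg (coeff n) h2
  rw [sub_mul, one_mul, map_sub, coeff_derivative, coeff_C_mul] at h3
  cases n with
  | zero => simpa using h3
  | succ n =>
    rw [coeff_succ_X_mul, coeff_derivative] at h3
    push_cast at h3 ⊢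
    linarith

end PowerSeries

open PowerSeries in
-- The `j`-th power is the series of `(1 - X) ^ (-jα)`, so successive coefficients have ratio `1 - β
-- / (n + 1)` with `β = 1 - jα`. This is at most `((n + 2) / (n + 1)) ^ (-β)`, and the product
-- telescopes; no convolution is estimated.
lemma coeff_mk_negBinomCoeff_pow_le {α : ℝ} (hα : 0 < α) {j : ℕ} (hj : j * α ≤ 1) (n : ℕ) :
    coeff n (mk (negBinomCoeff α) ^ j) ≤ ((n : ℝ) + 1) ^ (-(1 - j * α)) := by
  have hrec := coeff_succ_pow_of_coeff_succ (F := mk (negBinomCoeff α)) (α := α)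
    (fun n => by simpa only [coeff_mk] using negBinomCoeff_succ hα n) j
  have hnn : ∀ n, 0 ≤ coeff n (mk (negBinomCoeff α) ^ j) := by
    refine coeff_pow_nonneg (fun n => ?_) j
    rw [coeff_mk]
    unfold negBinomCoeff
    have := Real.Gamma_pos_of_pos hα
    have := Real.Gamma_pos_of_pos (show (0 : ℝ) < n + α by positivity)
    positivity
  induction n with
  | zero => simp [negBinomCoeff_zero hα]
  | succ n ih =>
    set β : ℝ := 1 - j * α with hβ
    have hn1 : (0 : ℝ) < n + 1 := by positivity
    have h1 : coeff (n + 1) (mk (negBinomCoeff α) ^ j) =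
        (1 - β / (n + 1)) * coeff n (mk (negBinomCoeff α) ^ j) := by
      have := hrec n
      field_simp
      rw [mul_comm, mul_comm _ (coeff n _)]
      rw [mul_comm] at this
      rw [this, hβ]; ring
    have h2 : 1 - β / (n + 1) ≤ (((n : ℝ) + 1 + 1) / (n + 1)) ^ (-β) := by
      have hpos : (0 : ℝ) < ((n : ℝ) + 1 + 1) / (n + 1) := by positivity
      have hlog : Real.log (((n : ℝ) + 1 + 1) / (n + 1)) ≤ 1 / (n + 1) := by
        have := Real.log_le_sub_one_of_pos hpos
        have h : ((n : ℝ) + 1 + 1) / (n + 1) - 1 = 1 / (n + 1) := by field_simp; ring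
        linarith
      rw [Real.rpow_def_of_pos hpos]
      have h3 := Real.add_one_le_exp (Real.log (((n : ℝ) + 1 + 1) / (n + 1)) * -β)
      have h4 := mul_le_mul_of_nonneg_right hlog (show 0 ≤ β by rw [hβ]; linarith)
      rw [one_div_mul_eq_div] at h4
      linarith
    rw [h1]
    push_cast
    calc _ ≤ (((n : ℝ) + 1 + 1) / (n + 1)) ^ (-β) * coeff n (mk (negBinomCoeff α) ^ j) :=
          mul_le_mul_of_nonneg_right h2 (hnn n)
      _ ≤ (((n : ℝ) + 1 + 1) / (n + 1)) ^ (-β) * ((n : ℝ) + 1) ^ (-β) :=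
          mul_le_mul_of_nonneg_left ih (by positivity)
      _ = _ := by
        rw [← Real.mul_rpow (by positivity) (by positivity)]
        congr 1
        field_simp

open PowerSeries in
-- Termwise domination by `K X (1 - X) ^ (-1/s)` passes to powers because all coefficients are
-- nonnegative; the factor `X ^ j` produces the shift by `j`.
lemma coeff_mk_powerDensity_pow_le {s : ℕ} (hs : 2 ≤ s) {j : ℕ} (hj : j ≤ s) (n : ℕ) :
    coeff n (mk (powerDensity s) ^ j) ≤ (Real.Gamma (1 / (s : ℝ)) / s) ^ j *
      if j ≤ n then (((n - j : ℕ) : ℝ) + 1) ^ (-(1 - j * (1 / (s : ℝ)))) else 0 := by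
  have hα : (0 : ℝ) < 1 / s := by positivity
  have hK : 0 ≤ Real.Gamma (1 / (s : ℝ)) / s :=
    div_nonneg (Real.Gamma_pos_of_pos hα).le (by positivity)
  set K := Real.Gamma (1 / (s : ℝ)) / s with hKdef
  set α : ℝ := 1 / (s : ℝ) with hαdef
  have h1 : coeff n (mk (powerDensity s) ^ j) ≤
      coeff n ((C K * (X * mk (negBinomCoeff α))) ^ j) := by
    refine coeff_pow_le (fun n => ?_) (fun n => ?_) j n
    · rw [coeff_mk]; exact powerDensity_nonneg s n
    · rw [coeff_mk, coeff_C_mul]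
      cases n with
      | zero => simp [powerDensity_zero hs]
      | succ n => rw [coeff_succ_X_mul, coeff_mk]; exact powerDensity_succ_le hs n
  refine h1.trans ?_
  rw [mul_pow, mul_pow, ← map_pow, coeff_C_mul, coeff_X_pow_mul']
  refine mul_le_mul_of_nonneg_left ?_ (by positivity)
  split_ifs
  · refine coeff_mk_negBinomCoeff_pow_le hα ?_ _
    rw [hαdef, mul_one_div, div_le_one (by positivity)]
    exact_mod_cast hj
  · exact le_rfl

open PowerSeries in
/-- The expected number of representations as a sum of `s` pseudo `s`-th powers is bounded. -/
lemma coeff_mk_powerDensity_pow_self_le {s : ℕ} (hs : 2 ≤ s) (n : ℕ) :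
    coeff n (mk (powerDensity s) ^ s) ≤ (Real.Gamma (1 / (s : ℝ)) / s) ^ s := by
  have hα : (0 : ℝ) < 1 / s := by positivity
  have hK : 0 ≤ Real.Gamma (1 / (s : ℝ)) / s :=
    div_nonneg (Real.Gamma_pos_of_pos hα).le (by positivity)
  refine (coeff_mk_powerDensity_pow_le hs le_rfl n).trans ?_
  refine mul_le_of_le_one_right (by positivity) ?_
  split_ifs
  · rw [mul_one_div_cancel (by positivity)]; simp
  · norm_num

open PowerSeries in
lemma coeff_mk_powerDensity_pow_le_rpow {s : ℕ} (hs : 2 ≤ s) {j : ℕ} (hj0 : 1 ≤ j) (hj : j < s)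
    {n : ℕ} {t : ℝ} (ht : 0 < t) (htn : t ≤ n) :
    coeff n (mk (powerDensity s) ^ j) ≤
      max 1 (Real.Gamma (1 / (s : ℝ)) / s) ^ s * (t / s) ^ (-(1 / (s : ℝ))) := by
  have hs0 : (0 : ℝ) < s := by positivity
  have hα : (0 : ℝ) < 1 / s := by positivity
  have hK : 0 ≤ Real.Gamma (1 / (s : ℝ)) / s :=
    div_nonneg (Real.Gamma_pos_of_pos hα).le (by positivity)
  refine (coeff_mk_powerDensity_pow_le hs hj.le n).trans ?_
  have h1 : (Real.Gamma (1 / (s : ℝ)) / s) ^ j ≤ max 1 (Real.Gamma (1 / (s : ℝ)) / s) ^ s :=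
    (pow_le_pow_left₀ hK (le_max_right _ _) j).trans
      (pow_le_pow_right₀ (le_max_left _ _) hj.le)
  refine mul_le_mul h1 ?_ ?_ (by positivity)
  · split_ifs with h
    · have hj' : (1 : ℝ) ≤ j := by exact_mod_cast hj0
      have hjs : (j : ℝ) + 1 ≤ s := by exact_mod_cast hj
      have hjn : (j : ℝ) ≤ n := by exact_mod_cast h
      rw [Nat.cast_sub h]
      -- Dividing by `s` absorbs the shift by `j`, even when `n` is close to `j`.
      have h2 : t / s ≤ (n : ℝ) - j + 1 := by
        rw [div_le_iff₀ hs0]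
        nlinarith
      refine (Real.rpow_le_rpow_of_exponent_le (by linarith) ?_).trans
        (Real.rpow_le_rpow_of_nonpos (by positivity) h2 (by linarith))
      have : (j : ℝ) * (1 / s) + 1 / s ≤ 1 := by
        rw [← add_one_mul, mul_one_div, div_le_one hs0]; exact hjs
      linarith
    · positivity
  · split_ifs <;> positivity

open PowerSeries in
lemma coeff_mk_powerDensity_pow_le_max {s : ℕ} (hs : 2 ≤ s) {j : ℕ} (hj : j ≤ s) (n : ℕ) :
    coeff n (mk (powerDensity s) ^ j) ≤ max 1 (Real.Gamma (1 / (s : ℝ)) / s) ^ s := by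
  have hs0 : (0 : ℝ) < s := by positivity
  have hα : (0 : ℝ) < 1 / s := by positivity
  have hK : 0 ≤ Real.Gamma (1 / (s : ℝ)) / s :=
    div_nonneg (Real.Gamma_pos_of_pos hα).le (by positivity)
  refine (coeff_mk_powerDensity_pow_le hs hj n).trans ?_
  have h1 : (Real.Gamma (1 / (s : ℝ)) / s) ^ j ≤ max 1 (Real.Gamma (1 / (s : ℝ)) / s) ^ s :=
    (pow_le_pow_left₀ hK (le_max_right _ _) j).trans
      (pow_le_pow_right₀ (le_max_left _ _) hj)
  refine (mul_le_of_le_one_right (by positivity) ?_).trans h1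
  split_ifs
  · have hjs : (j : ℝ) ≤ s := by exact_mod_cast hj
    have : (j : ℝ) * (1 / s) ≤ 1 := by rw [mul_one_div, div_le_one hs0]; exact hjs
    refine Real.rpow_le_one_of_one_le_of_nonpos ?_ (by linarith)
    have : (0 : ℝ) ≤ ((n - j : ℕ) : ℝ) := Nat.cast_nonneg _
    linarith
  · norm_num

/-! ### Sets with a prescribed sum, and pairs of overlapping sets. -/

/-- The sets of `j` natural numbers with sum `t`. -/
def sumSets (j t : ℕ) : Finset (Finset ℕ) :=
  ((Finset.range (t + 1)).powersetCard j).filter fun S => ∑ i ∈ S, i = t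

/-- The weighted number of sets of `j` natural numbers with sum `t`. -/
noncomputable def repSum (f : ℕ → ℝ) (j t : ℕ) : ℝ := ∑ S ∈ sumSets j t, ∏ i ∈ S, f i

lemma mem_sumSets {j t : ℕ} {S : Finset ℕ} :
    S ∈ sumSets j t ↔ S.card = j ∧ ∑ i ∈ S, i = t := by
  rw [sumSets, Finset.mem_filter, Finset.mem_powersetCard]
  refine ⟨fun h => ⟨h.1.2, h.2⟩, fun h => ⟨⟨fun i hi => ?_, h.1⟩, h.2⟩⟩
  have := Finset.single_le_sum (f := fun i : ℕ => i) (fun _ _ => Nat.zero_le _) hi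
  rw [Finset.mem_range]
  omega

lemma Finset.sum_le_sum_of_injOn {ι κ : Type*} {s : Finset ι} {t : Finset κ} {f : ι → ℝ}
    {g : κ → ℝ} (e : ι → κ) (he : ∀ i ∈ s, e i ∈ t) (hinj : Set.InjOn e s)
    (hfg : ∀ i ∈ s, f i ≤ g (e i)) (hg : ∀ k ∈ t, 0 ≤ g k) : ∑ i ∈ s, f i ≤ ∑ k ∈ t, g k := by
  classical
  refine (Finset.sum_le_sum hfg).trans ?_
  rw [← Finset.sum_image (f := g) hinj]
  refine Finset.sum_le_sum_of_subset_of_nonneg ?_ fun k hk _ => hg k hk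
  intro k hk
  obtain ⟨i, hi, rfl⟩ := Finset.mem_image.1 hk
  exact he i hi

lemma repSum_nonneg {f : ℕ → ℝ} (hf : ∀ n, 0 ≤ f n) (j t : ℕ) : 0 ≤ repSum f j t :=
  Finset.sum_nonneg fun _ _ => Finset.prod_nonneg fun _ _ => hf _

open PowerSeries in
-- Each `j`-set comes from `j!` ordered tuples; this is the source of `s!` in `λ_s`. The induction
-- marks an element `a` of `S` and removes it, which is injective on pairs `(S, a)`.
lemma factorial_mul_repSum_le {f : ℕ → ℝ} (hf : ∀ n, 0 ≤ f n) (j t : ℕ) :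
    j.factorial * repSum f j t ≤ coeff t (mk f ^ j) := by
  induction j generalizing t with
  | zero =>
    have h : ∀ S ∈ sumSets 0 t, S = ∅ ∧ t = 0 := by
      intro S hS
      obtain ⟨h1, h2⟩ := mem_sumSets.1 hS
      rw [Finset.card_eq_zero] at h1
      subst h1
      exact ⟨rfl, by simpa using h2.symm⟩
    rw [pow_zero, coeff_one, Nat.factorial_zero, Nat.cast_one, one_mul, repSum]
    split_ifs with ht
    · calc _ ≤ ∑ S ∈ {∅}, ∏ i ∈ S, f i := Finset.sum_le_sum_of_subset_of_nonneg
            (fun S hS => Finset.mem_singleton.2 (h S hS).1)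
            fun _ _ _ => Finset.prod_nonneg fun _ _ => hf _
        _ = 1 := by simp
    · refine (Finset.sum_eq_zero fun S hS => absurd (h S hS).2 ht).le
  | succ j ih =>
    have h1 : ((j : ℝ) + 1) * repSum f (j + 1) t ≤
        ∑ q ∈ Finset.HasAntidiagonal.antidiagonal t, f q.1 * repSum f j q.2 := by
      calc _ = ∑ S ∈ sumSets (j + 1) t, ∑ a ∈ S, ∏ i ∈ S, f i := by
            rw [repSum, Finset.mul_sum]
            refine Finset.sum_congr rfl fun S hS => ?_
            rw [Finset.sum_const, (mem_sumSets.1 hS).1, nsmul_eq_mul]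
            push_cast; rfl
        _ ≤ ∑ q ∈ Finset.HasAntidiagonal.antidiagonal t, ∑ S ∈ sumSets j q.2, f q.1 * ∏ i ∈ S, f i := by
            rw [Finset.sum_sigma', Finset.sum_sigma']
            refine Finset.sum_le_sum_of_injOn
              (fun z => ⟨(z.2, t - z.2), z.1.erase z.2⟩) ?_ ?_ ?_ ?_
            · rintro ⟨S, a⟩ h
              obtain ⟨hS, ha⟩ := Finset.mem_sigma.1 h
              obtain ⟨hc, hs⟩ := mem_sumSets.1 hS
              dsimp only at ha hc hs
              have hadd : a + ∑ i ∈ S.erase a, i = ∑ i ∈ S, i :=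
                Finset.add_sum_erase S (fun i => i) ha
              simp only [Finset.mem_sigma, Finset.HasAntidiagonal.mem_antidiagonal, mem_sumSets]
              refine ⟨by omega, ?_, by omega⟩
              rw [Finset.card_erase_of_mem ha, hc]; rfl
            · rintro ⟨S, a⟩ h ⟨S', a'⟩ h' heq
              have ha := (Finset.mem_sigma.1 h).2
              have ha' := (Finset.mem_sigma.1 h').2
              dsimp only at ha ha'
              simp only [Sigma.mk.injEq, Prod.mk.injEq] at heq
              obtain ⟨⟨rfl, -⟩, h3⟩ := heq
              have h4 : S = S' := by
                rw [← Finset.insert_erase ha, eq_of_heq h3, Finset.insert_erase ha']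
              subst h4
              rfl
            · rintro ⟨S, a⟩ h
              exact (Finset.mul_prod_erase S f (Finset.mem_sigma.1 h).2).ge
            · intro k _
              exact mul_nonneg (hf _) (Finset.prod_nonneg fun _ _ => hf _)
        _ = _ := by simp only [repSum, Finset.mul_sum]
    rw [pow_succ', coeff_mul, Nat.factorial_succ]
    push_cast
    calc _ = (j.factorial : ℝ) * (((j : ℝ) + 1) * repSum f (j + 1) t) := by ring
      _ ≤ (j.factorial : ℝ) * ∑ q ∈ Finset.HasAntidiagonal.antidiagonal t, f q.1 * repSum f j q.2 :=
        mul_le_mul_of_nonneg_left h1 (by positivity)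
      _ ≤ _ := by
        rw [Finset.mul_sum]
        refine Finset.sum_le_sum fun q _ => ?_
        rw [coeff_mk, mul_left_comm]
        exact mul_le_mul_of_nonneg_left (ih _) (hf _)

open PowerSeries in
lemma repSum_le_coeff {f : ℕ → ℝ} (hf : ∀ n, 0 ≤ f n) (j t : ℕ) :
    repSum f j t ≤ coeff t (mk f ^ j) := by
  refine le_trans ?_ (factorial_mul_repSum_le hf j t)
  refine le_mul_of_one_le_left (repSum_nonneg hf j t) ?_
  exact_mod_cast j.factorial_pos

open PowerSeries in
lemma sum_repSum_mul_repSum_le {f : ℕ → ℝ} (hf : ∀ n, 0 ≤ f n) (j k t : ℕ) :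
    ∑ u ∈ Finset.range (t + 1), repSum f j u * repSum f k (t - u) ≤
      coeff t (mk f ^ (j + k)) := by
  rw [pow_add, coeff_mul, Finset.Nat.sum_antidiagonal_eq_sum_range_succ
    (fun a b => coeff a (mk f ^ j) * coeff b (mk f ^ k))]
  refine Finset.sum_le_sum fun u _ => mul_le_mul (repSum_le_coeff hf _ _)
    (repSum_le_coeff hf _ _) (repSum_nonneg hf _ _) ?_
  exact (repSum_nonneg hf _ _).trans (repSum_le_coeff hf _ _)

/-- The weighted number of pairs of distinct, intersecting `s`-sets with sums `x` and `y`. -/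
noncomputable def overlapSum (f : ℕ → ℝ) (s x y : ℕ) : ℝ :=
  ∑ q ∈ (sumSets s x ×ˢ sumSets s y).filter (fun q => q.1 ≠ q.2 ∧ ¬ Disjoint q.1 q.2),
    ∏ i ∈ q.1 ∪ q.2, f i

/-- A pair `(S, T)` is encoded by `S ∩ T`, `S \ T` and `T \ S`, where `k` and `u` are the size and
sum of the intersection. Being distinct and intersecting forces `1 ≤ k < s`. -/
lemma overlapSum_le_sum {f : ℕ → ℝ} (hf : ∀ n, 0 ≤ f n) (s x y : ℕ) :
    overlapSum f s x y ≤ ∑ k ∈ Finset.Ico 1 s, ∑ u ∈ (Finset.range (x + 1)).filter (· ≤ y),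
      repSum f k u * (repSum f (s - k) (x - u) * repSum f (s - k) (y - u)) := by
  have h : ∀ k u, repSum f k u * (repSum f (s - k) (x - u) * repSum f (s - k) (y - u)) =
      ∑ z ∈ sumSets k u ×ˢ (sumSets (s - k) (x - u) ×ˢ sumSets (s - k) (y - u)),
        (∏ i ∈ z.1, f i) * ((∏ i ∈ z.2.1, f i) * ∏ i ∈ z.2.2, f i) := by
    intro k u
    simp only [repSum]
    rw [Finset.sum_mul_sum (sumSets (s - k) (x - u)), ← Finset.sum_product',
      Finset.sum_mul_sum (sumSets k u), ← Finset.sum_product']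
  simp only [h]
  rw [← Finset.sum_product' (f := fun k u =>
    ∑ z ∈ sumSets k u ×ˢ (sumSets (s - k) (x - u) ×ˢ sumSets (s - k) (y - u)),
        (∏ i ∈ z.1, f i) * ((∏ i ∈ z.2.1, f i) * ∏ i ∈ z.2.2, f i)), Finset.sum_sigma',
    overlapSum]
  refine Finset.sum_le_sum_of_injOn (fun q => ⟨((q.1 ∩ q.2).card, ∑ i ∈ q.1 ∩ q.2, i),
    (q.1 ∩ q.2, (q.1 \ q.2, q.2 \ q.1))⟩) ?_ ?_ ?_ ?_
  · rintro ⟨S, T⟩ hq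
    simp only [Finset.mem_filter, Finset.mem_product, mem_sumSets] at hq
    obtain ⟨⟨⟨hSc, hSs⟩, hTc, hTs⟩, hne, hdis⟩ := hq
    have c1 := Finset.card_inter_add_card_sdiff S T
    have c2 := Finset.card_inter_add_card_sdiff T S
    have s1 := Finset.sum_inter_add_sum_sdiff S T (fun i => i)
    have s2 := Finset.sum_inter_add_sum_sdiff T S (fun i => i)
    rw [Finset.inter_comm T S] at c2 s2
    have hpos : 1 ≤ (S ∩ T).card :=
      Finset.card_pos.2 (Finset.not_disjoint_iff_nonempty_inter.1 hdis)
    have hlt : (S ∩ T).card < s := by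
      rcases lt_or_ge (S ∩ T).card s with h | h
      · exact h
      · have e1 := Finset.eq_of_subset_of_card_le (Finset.inter_subset_left (s₁ := S) (s₂ := T))
          (by omega)
        have e2 := Finset.eq_of_subset_of_card_le (Finset.inter_subset_right (s₁ := S) (s₂ := T))
          (by omega)
        exact absurd (e1.symm.trans e2) hne
    simp only [Finset.mem_sigma, Finset.mem_product, Finset.mem_Ico, Finset.mem_filter,
      Finset.mem_range, mem_sumSets]
    refine ⟨⟨⟨hpos, hlt⟩, ?_, ?_⟩, ⟨trivial, trivial⟩, ⟨?_, ?_⟩, ?_, ?_⟩ <;> omega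
  · rintro ⟨S, T⟩ - ⟨S', T'⟩ - heq
    simp only [Sigma.mk.injEq] at heq
    have h2 := eq_of_heq heq.2
    simp only [Prod.mk.injEq] at h2
    obtain ⟨e1, e2, e3⟩ := h2
    have hS : S = S' := by
      rw [← Finset.sdiff_union_inter S T, e1, e2, Finset.sdiff_union_inter]
    have hT : T = T' := by
      rw [← Finset.sdiff_union_inter T S, Finset.inter_comm, e1, e3, Finset.inter_comm,
        Finset.sdiff_union_inter]
    rw [hS, hT]
  · rintro ⟨S, T⟩ -
    refine le_of_eq ?_
    dsimp only
    have e : S ∪ T = (S ∩ T) ∪ ((S \ T) ∪ (T \ S)) := by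
      ext i
      simp only [Finset.mem_union, Finset.mem_inter, Finset.mem_sdiff]
      tauto
    rw [e, Finset.prod_union, Finset.prod_union]
    · rw [Finset.disjoint_left]; intro i hi hi'
      simp only [Finset.mem_sdiff] at hi hi'
      tauto
    · rw [Finset.disjoint_left]; intro i hi hi'
      simp only [Finset.mem_union, Finset.mem_inter, Finset.mem_sdiff] at hi hi'
      tauto
  · intro z _
    exact mul_nonneg (Finset.prod_nonneg fun _ _ => hf _)
      (mul_nonneg (Finset.prod_nonneg fun _ _ => hf _) (Finset.prod_nonneg fun _ _ => hf _))

/-- The sum over `u` is split by the size of `y - u`. If `y - u ≥ t`, the last factor is at most `a`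
and the other two form a convolution bounded by `C`. Otherwise `u` takes at most `t + 1` values, all
above `y - t`, where the first factor is at most `b`. -/
lemma overlapSum_le {f : ℕ → ℝ} (hf : ∀ n, 0 ≤ f n) {s x y : ℕ} {a b C t : ℝ}
    (ha0 : 0 ≤ a) (hb0 : 0 ≤ b) (hC0 : 0 ≤ C) (ht0 : 0 ≤ t)
    (ha : ∀ j n : ℕ, 1 ≤ j → j < s → t ≤ n → repSum f j n ≤ a)
    (hb : ∀ j n : ℕ, 1 ≤ j → j < s → y - t ≤ n → repSum f j n ≤ b)
    (hC : ∀ j n : ℕ, j ≤ s → repSum f j n ≤ C)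
    (hconv : ∀ j ≤ s, ∑ u ∈ Finset.range (x + 1), repSum f j u * repSum f (s - j) (x - u) ≤ C) :
    overlapSum f s x y ≤ s * (C * a + (t + 1) * (b * C ^ 2)) := by
  have hr := repSum_nonneg hf
  have main : ∀ k ∈ Finset.Ico 1 s, ∑ u ∈ (Finset.range (x + 1)).filter (· ≤ y),
      repSum f k u * (repSum f (s - k) (x - u) * repSum f (s - k) (y - u)) ≤
      C * a + (t + 1) * (b * C ^ 2) := by
    intro k hk
    obtain ⟨hk1, hks⟩ := Finset.mem_Ico.1 hk
    rw [← Finset.sum_filter_add_sum_filter_not _ (fun u : ℕ => t ≤ ((y - u : ℕ) : ℝ))]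
    refine add_le_add ?_ ?_
    · calc _ ≤ ∑ u ∈ ((Finset.range (x + 1)).filter (· ≤ y)).filter
            (fun u : ℕ => t ≤ ((y - u : ℕ) : ℝ)),
              repSum f k u * repSum f (s - k) (x - u) * a := by
            refine Finset.sum_le_sum fun u hu => ?_
            rw [← mul_assoc]
            exact mul_le_mul_of_nonneg_left (ha _ _ (by omega) (by omega)
              (Finset.mem_filter.1 hu).2) (mul_nonneg (hr _ _) (hr _ _))
        _ ≤ ∑ u ∈ Finset.range (x + 1), repSum f k u * repSum f (s - k) (x - u) * a := by
            refine Finset.sum_le_sum_of_subset_of_nonneg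
              ((Finset.filter_subset _ _).trans (Finset.filter_subset _ _)) fun u _ _ => ?_
            exact mul_nonneg (mul_nonneg (hr _ _) (hr _ _)) ha0
        _ ≤ C * a := by
            rw [← Finset.sum_mul]
            exact mul_le_mul_of_nonneg_right (hconv k hks.le) ha0
    · have hcard : ((((Finset.range (x + 1)).filter (· ≤ y)).filter
          (fun u : ℕ => ¬ t ≤ ((y - u : ℕ) : ℝ))).card : ℝ) ≤ t + 1 := by
        have : ((((Finset.range (x + 1)).filter (· ≤ y)).filter
          (fun u : ℕ => ¬ t ≤ ((y - u : ℕ) : ℝ))).card) ≤ (Finset.range (⌊t⌋₊ + 1)).card := by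
          refine Finset.card_le_card_of_injOn (fun u => y - u) ?_ ?_
          · intro u hu
            simp only [Finset.coe_filter, Finset.mem_filter, Set.mem_ofPred_eq, not_le] at hu
            have := Nat.le_floor hu.2.le
            simpa using Nat.lt_succ_of_le this
          · intro u hu v hv huv
            simp only [Finset.coe_filter, Finset.mem_filter, Set.mem_ofPred_eq] at hu hv
            dsimp only at huv
            omega
        rw [Finset.card_range] at this
        have h2 : ((⌊t⌋₊ + 1 : ℕ) : ℝ) ≤ t + 1 := by
          push_cast; linarith [Nat.floor_le ht0]
        exact (by exact_mod_cast this : _ ≤ ((⌊t⌋₊ + 1 : ℕ) : ℝ)).trans h2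
      refine (Finset.sum_le_card_nsmul _ _ (b * C ^ 2) fun u hu => ?_).trans ?_
      · simp only [Finset.mem_filter, not_le] at hu
        obtain ⟨⟨_, huy⟩, hut⟩ := hu
        rw [Nat.cast_sub huy] at hut
        rw [sq]
        exact mul_le_mul (hb _ _ hk1 hks (by linarith))
          (mul_le_mul (hC _ _ (by omega)) (hC _ _ (by omega)) (hr _ _) hC0)
          (mul_nonneg (hr _ _) (hr _ _)) hb0
      · rw [nsmul_eq_mul]
        exact mul_le_mul_of_nonneg_right hcard (by positivity)
  refine (overlapSum_le_sum hf s x y).trans ((Finset.sum_le_card_nsmul _ _ _ main).trans ?_)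
  rw [nsmul_eq_mul, Nat.card_Ico]
  refine mul_le_mul_of_nonneg_right ?_ (by positivity)
  exact_mod_cast Nat.sub_le s 1

section PowerDensity

variable {s : ℕ}

lemma repSum_powerDensity_le_lambdaConst (hs : 2 ≤ s) (t : ℕ) :
    repSum (powerDensity s) s t ≤ lambdaConst s := by
  have h := (factorial_mul_repSum_le (powerDensity_nonneg s) s t).trans
    (coeff_mk_powerDensity_pow_self_le hs t)
  have hf : (0 : ℝ) < s.factorial := by exact_mod_cast s.factorial_pos
  rw [lambdaConst, ← div_div, ← div_pow, le_div_iff₀ hf, mul_comm]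
  exact h

/-- A bound for the overlap sums which decays polynomially. -/
lemma overlapSum_powerDensity_le (hs : 2 ≤ s) {x y : ℕ} {L t : ℝ} (hL : 0 < L) (ht : 0 < t)
    (htL : t ≤ L / 2) (hy : L ≤ y) :
    overlapSum (powerDensity s) s x y ≤ s * (max 1 (Real.Gamma (1 / (s : ℝ)) / s) ^ s) ^ 3 *
      ((t / s) ^ (-(1 / (s : ℝ))) + (t + 1) * (L / 2 / s) ^ (-(1 / (s : ℝ)))) := by
  have hf := powerDensity_nonneg s
  set C : ℝ := max 1 (Real.Gamma (1 / (s : ℝ)) / s) ^ s with hCdef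
  have hC1 : 1 ≤ C := one_le_pow₀ (le_max_left _ _)
  have h := overlapSum_le (f := powerDensity s) hf (s := s) (x := x) (y := y)
    (a := C * (t / s) ^ (-(1 / (s : ℝ)))) (b := C * (L / 2 / s) ^ (-(1 / (s : ℝ)))) (C := C)
    (t := t) (by positivity) (by positivity) (by positivity) ht.le
    (fun j n h1 h2 h3 => (repSum_le_coeff hf j n).trans
      (coeff_mk_powerDensity_pow_le_rpow hs h1 h2 ht h3))
    (fun j n h1 h2 h3 => (repSum_le_coeff hf j n).trans
      (coeff_mk_powerDensity_pow_le_rpow hs h1 h2 (by positivity) (by linarith)))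
    (fun j n h1 => (repSum_le_coeff hf j n).trans (coeff_mk_powerDensity_pow_le_max hs h1 n))
    (fun j h1 => (sum_repSum_mul_repSum_le hf j (s - j) x).trans (by
      rw [Nat.add_sub_cancel' h1]; exact coeff_mk_powerDensity_pow_le_max hs le_rfl x))
  refine h.trans ?_
  have hA : 0 ≤ (t / s) ^ (-(1 / (s : ℝ))) := by positivity
  have hB : 0 ≤ (t + 1) * (L / 2 / s) ^ (-(1 / (s : ℝ))) := by positivity
  have hs0 : (0 : ℝ) ≤ s := by positivity
  have h23 : C ^ 2 ≤ C ^ 3 := pow_le_pow_right₀ hC1 (by norm_num)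
  rw [mul_assoc (s : ℝ)]
  refine mul_le_mul_of_nonneg_left ?_ hs0
  calc _ = C ^ 2 * (t / s) ^ (-(1 / (s : ℝ))) +
        C ^ 3 * ((t + 1) * (L / 2 / s) ^ (-(1 / (s : ℝ)))) := by ring
    _ ≤ _ := by nlinarith

/-- Some element of `S` is at least the average `L / s`, and every other factor is at most 1. -/
lemma prod_powerDensity_le (hs : 2 ≤ s) {S : Finset ℕ} (hS : S.card = s) {L : ℝ} (hL : 0 < L)
    (hLS : L ≤ ((∑ i ∈ S, i : ℕ) : ℝ)) :
    ∏ i ∈ S, powerDensity s i ≤ (L / s) ^ (-(1 / (s : ℝ))) := by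
  classical
  have hs0 : (0 : ℝ) < s := by positivity
  have hne : S.Nonempty := Finset.card_pos.1 (by omega)
  obtain ⟨a, ha, hLa⟩ : ∃ a ∈ S, L / s ≤ (a : ℝ) := by
    refine Finset.exists_le_of_sum_le hne ?_
    rw [Finset.sum_const, hS, nsmul_eq_mul, mul_div_cancel₀ _ hs0.ne']
    rwa [← Nat.cast_sum]
  have hapos : 0 < a := by
    have : (0 : ℝ) < a := lt_of_lt_of_le (by positivity) hLa
    exact_mod_cast this
  have hle1 : ∀ i ∈ S.erase a, powerDensity s i ≤ 1 := by
    intro i _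
    rcases Nat.eq_zero_or_pos i with rfl | hi
    · rw [powerDensity_zero hs]; norm_num
    · refine (powerDensity_le hs hi).trans (Real.rpow_le_one_of_one_le_of_nonpos ?_ ?_)
      · exact_mod_cast hi
      · rw [neg_nonpos]; positivity
  rw [← Finset.mul_prod_erase S _ ha]
  calc _ ≤ powerDensity s a := mul_le_of_le_one_right (powerDensity_nonneg s a)
        (Finset.prod_le_one (fun _ _ => powerDensity_nonneg s _) hle1)
    _ ≤ (a : ℝ) ^ (-(1 / (s : ℝ))) := powerDensity_le hs hapos
    _ ≤ _ := Real.rpow_le_rpow_of_nonpos (by positivity) hLa (by rw [neg_nonpos]; positivity)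

end PowerDensity

/-! ### The second moment method. -/

lemma exp_neg_mul_le_one_sub {x q : ℝ} (hx0 : 0 ≤ x) (hxq : x ≤ q) (hq : q ≤ 1 / 2) :
    Real.exp (-((1 + 2 * q) * x)) ≤ 1 - x := by
  have h1 : 0 < 1 - x := by linarith
  rw [← Real.le_log_iff_exp_le h1]
  refine le_trans ?_ (Real.one_sub_inv_le_log_of_pos h1)
  have h2 : (1 - x)⁻¹ ≤ 1 + (1 + 2 * q) * x := by
    rw [inv_le_iff_one_le_mul₀ h1]
    nlinarith [mul_nonneg hx0 (sub_nonneg.2 hxq), mul_nonneg hx0 hx0,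
      mul_nonneg (mul_nonneg hx0 hx0) (by linarith : (0 : ℝ) ≤ 1 / 2 - q),
      mul_nonneg (mul_nonneg hx0 (sub_nonneg.2 hxq)) (by linarith : (0 : ℝ) ≤ 1 / 2 - x)]
  linarith

/-- The second moment method. -/
lemma measure_compl_biUnion_mul_sq_le {Ω ι : Type*} [MeasurableSpace Ω] {P : Measure Ω}
    [IsProbabilityMeasure P] (G : Finset ι) {E : ι → Set Ω} (hE : ∀ i, MeasurableSet (E i)) :
    P.real (⋃ i ∈ G, E i)ᶜ * (∑ i ∈ G, P.real (E i)) ^ 2 ≤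
      ∑ i ∈ G, ∑ j ∈ G, P.real (E i ∩ E j) - (∑ i ∈ G, P.real (E i)) ^ 2 := by
  set μ : ℝ := ∑ i ∈ G, P.real (E i) with hμ
  set U : Set Ω := (⋃ i ∈ G, E i)ᶜ with hU
  have hUm : MeasurableSet U := (Finset.measurableSet_biUnion _ fun i _ => hE i).compl
  have hI : ∀ S : Set Ω, MeasurableSet S → Integrable (S.indicator (1 : Ω → ℝ)) P :=
    fun S hS => (integrable_const (1 : ℝ)).indicator hS
  set X : Ω → ℝ := fun ω => ∑ i ∈ G, (E i).indicator (1 : Ω → ℝ) ω with hX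
  have hXint : Integrable X P := integrable_finsetSum _ fun i _ => hI _ (hE i)
  have hX1 : ∫ ω, X ω ∂P = μ := by
    rw [hX, integral_finsetSum _ fun i _ => hI _ (hE i)]
    exact Finset.sum_congr rfl fun i _ => integral_indicator_one (hE i)
  have hsq : ∀ ω, X ω ^ 2 = ∑ i ∈ G, ∑ j ∈ G, (E i ∩ E j).indicator (1 : Ω → ℝ) ω := by
    intro ω
    rw [sq, hX, Finset.sum_mul_sum]
    refine Finset.sum_congr rfl fun i _ => Finset.sum_congr rfl fun j _ => ?_
    rw [Set.inter_indicator_one]; rfl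
  have hX2int : Integrable (fun ω => X ω ^ 2) P := by
    simp only [hsq]
    exact integrable_finsetSum _ fun i _ => integrable_finsetSum _ fun j _ =>
      hI _ ((hE i).inter (hE j))
  have hX2 : ∫ ω, X ω ^ 2 ∂P = ∑ i ∈ G, ∑ j ∈ G, P.real (E i ∩ E j) := by
    simp only [hsq]
    rw [integral_finsetSum _ fun i _ => integrable_finsetSum _ fun j _ =>
      hI _ ((hE i).inter (hE j))]
    refine Finset.sum_congr rfl fun i _ => ?_
    rw [integral_finsetSum _ fun j _ => hI _ ((hE i).inter (hE j))]
    exact Finset.sum_congr rfl fun j _ => integral_indicator_one ((hE i).inter (hE j))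
  -- Chebyshev's inequality pointwise: where no event occurs `X = 0`, so `μ² 1_U ≤ (X - μ)²`.
  have hle : ∀ ω, μ ^ 2 * U.indicator (1 : Ω → ℝ) ω ≤ X ω ^ 2 - 2 * μ * X ω + μ ^ 2 := by
    intro ω
    by_cases hω : ω ∈ U
    · have : X ω = 0 := by
        refine Finset.sum_eq_zero fun i hi => Set.indicator_of_notMem (fun h => hω ?_) _
        exact Set.mem_biUnion (Finset.mem_coe.2 hi) h
      simp [this, hω]
    · rw [Set.indicator_of_notMem hω]
      nlinarith [sq_nonneg (X ω - μ)]
  have hint := integral_mono ((hI U hUm).const_mul (μ ^ 2))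
    ((hX2int.sub (hXint.const_mul (2 * μ))).add (integrable_const (μ ^ 2))) hle
  have e1 : ∫ ω, μ ^ 2 * U.indicator (1 : Ω → ℝ) ω ∂P = μ ^ 2 * P.real U := by
    rw [integral_const_mul, integral_indicator_one hUm]
  have e2 : ∫ ω, (X ω ^ 2 - 2 * μ * X ω + μ ^ 2) ∂P =
      ∑ i ∈ G, ∑ j ∈ G, P.real (E i ∩ E j) - 2 * μ * μ + μ ^ 2 := by
    have hsub : Integrable (fun ω => X ω ^ 2 - 2 * μ * X ω) P :=
      hX2int.sub (hXint.const_mul (2 * μ))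
    rw [integral_add hsub (integrable_const (μ ^ 2)),
      integral_sub hX2int (hXint.const_mul (2 * μ)), hX2, integral_const_mul, hX1]
    simp
  change ∫ ω, μ ^ 2 * U.indicator (1 : Ω → ℝ) ω ∂P ≤
    ∫ ω, (X ω ^ 2 - 2 * μ * X ω + μ ^ 2) ∂P at hint
  rw [e1, e2] at hint
  nlinarith

/-- The second moment method for events that are almost uncorrelated, up to few exceptions. -/
lemma measure_compl_biUnion_le {Ω ι : Type*} [MeasurableSpace Ω] {P : Measure Ω}
    [IsProbabilityMeasure P] {G : Finset ι} {E : ι → Set Ω} (hE : ∀ i, MeasurableSet (E i))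
    (R : ι → ι → Prop) [∀ i, DecidablePred (R i)] {r h e : ℝ} (hG : G.Nonempty) (he : 0 < e)
    (hlow : ∀ i ∈ G, e ≤ P.real (E i))
    (hR : ∀ i ∈ G, ((G.filter (R i)).card : ℝ) ≤ r)
    (hcorr : ∀ i ∈ G, ∀ j ∈ G, ¬ R i j →
      P.real (E i ∩ E j) ≤ P.real (E i) * P.real (E j) * Real.exp h) :
    P.real (⋃ i ∈ G, E i)ᶜ ≤ Real.exp h - 1 + r / (G.card * e) := by
  have hsm := measure_compl_biUnion_mul_sq_le (P := P) G hE
  set μ : ℝ := ∑ i ∈ G, P.real (E i) with hμ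
  have hμe : G.card * e ≤ μ := by
    rw [← nsmul_eq_mul]; exact Finset.card_nsmul_le_sum _ _ _ hlow
  have hGe : 0 < G.card * e := mul_pos (by exact_mod_cast hG.card_pos) he
  have hμ0 : 0 < μ := hGe.trans_le hμe
  have hr : 0 ≤ r := by
    obtain ⟨i, hi⟩ := hG
    exact (Nat.cast_nonneg _).trans (hR i hi)
  -- Related pairs are bounded trivially by `P(E i)`, at most `r` times for each `i`; for the rest
  -- the almost-product bound is summed and then extended to all `j`.
  have hsum : ∑ i ∈ G, ∑ j ∈ G, P.real (E i ∩ E j) ≤ μ * r + μ * μ * Real.exp h := by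
    rw [hμ, Finset.sum_mul, Finset.sum_mul, Finset.sum_mul, ← Finset.sum_add_distrib]
    refine Finset.sum_le_sum fun i hi => ?_
    rw [← Finset.sum_filter_add_sum_filter_not G (R i)]
    refine add_le_add ?_ ?_
    · refine (Finset.sum_le_card_nsmul _ _ (P.real (E i)) fun j _ =>
        measureReal_mono Set.inter_subset_left).trans ?_
      rw [nsmul_eq_mul, mul_comm]
      exact mul_le_mul_of_nonneg_left (hR i hi) measureReal_nonneg
    · rw [Finset.mul_sum, Finset.sum_mul]
      calc _ ≤ ∑ j ∈ G.filter (fun j => ¬ R i j),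
            P.real (E i) * P.real (E j) * Real.exp h := Finset.sum_le_sum fun j hj =>
              hcorr i hi j (Finset.mem_filter.1 hj).1 (Finset.mem_filter.1 hj).2
        _ ≤ _ := Finset.sum_le_sum_of_subset_of_nonneg (Finset.filter_subset _ _)
            fun j _ _ => by positivity
  have h1 : P.real (⋃ i ∈ G, E i)ᶜ ≤ Real.exp h - 1 + r / μ := by
    rw [← mul_le_mul_iff_left₀ (pow_pos hμ0 2)]
    have : (Real.exp h - 1 + r / μ) * μ ^ 2 = μ * r + μ * μ * Real.exp h - μ ^ 2 := by
      field_simp; ring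
    rw [this]; linarith
  refine h1.trans ?_
  gcongr

/-! ### Expected counts and correlations for families with sums in a given finite set. -/

section Families

variable {s : ℕ} {F : Finset (Finset ℕ)} {X : Finset ℕ} {f : ℕ → ℝ}

lemma sum_prod_le_card_mul (hf : ∀ n, 0 ≤ f n)
    (hF : ∀ S ∈ F, S.card = s ∧ ∑ i ∈ S, i ∈ X) {C : ℝ} (hC : ∀ x, repSum f s x ≤ C) :
    ∑ S ∈ F, ∏ i ∈ S, f i ≤ X.card * C := by
  rw [← Finset.sum_fiberwise_of_maps_to (t := X) (g := fun S => ∑ i ∈ S, i)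
    (fun S hS => (hF S hS).2), ← nsmul_eq_mul]
  refine Finset.sum_le_card_nsmul _ _ _ fun x _ => le_trans ?_ (hC x)
  refine Finset.sum_le_sum_of_subset_of_nonneg (fun S hS => ?_)
    fun _ _ _ => Finset.prod_nonneg fun _ _ => hf _
  obtain ⟨h1, h2⟩ := Finset.mem_filter.1 hS
  exact mem_sumSets.2 ⟨(hF S h1).1, h2⟩

lemma sum_overlap_le_card_sq_mul (hf : ∀ n, 0 ≤ f n)
    (hF : ∀ S ∈ F, S.card = s ∧ ∑ i ∈ S, i ∈ X) {D : ℝ}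
    (hD : ∀ x ∈ X, ∀ y ∈ X, overlapSum f s x y ≤ D) :
    ∑ q ∈ (F ×ˢ F).filter (fun q => q.1 ≠ q.2 ∧ ¬ Disjoint q.1 q.2), ∏ i ∈ q.1 ∪ q.2, f i ≤
      (X.card : ℝ) ^ 2 * D := by
  rw [← Finset.sum_fiberwise_of_maps_to (t := X ×ˢ X)
    (g := fun q : Finset ℕ × Finset ℕ => (∑ i ∈ q.1, i, ∑ i ∈ q.2, i)) (fun q hq => by
      obtain ⟨h1, h2⟩ := Finset.mem_product.1 (Finset.mem_filter.1 hq).1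
      exact Finset.mem_product.2 ⟨(hF _ h1).2, (hF _ h2).2⟩)]
  refine (Finset.sum_le_card_nsmul _ _ D fun z hz => ?_).trans ?_
  · obtain ⟨hz1, hz2⟩ := Finset.mem_product.1 hz
    refine le_trans ?_ (hD _ hz1 _ hz2)
    refine Finset.sum_le_sum_of_subset_of_nonneg (fun q hq => ?_)
      fun _ _ _ => Finset.prod_nonneg fun _ _ => hf _
    obtain ⟨h1, h2⟩ := Finset.mem_filter.1 hq
    obtain ⟨h3, h4⟩ := Finset.mem_filter.1 h1
    obtain ⟨h5, h6⟩ := Finset.mem_product.1 h3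
    refine Finset.mem_filter.2 ⟨Finset.mem_product.2 ⟨mem_sumSets.2 ⟨(hF _ h5).1, ?_⟩,
      mem_sumSets.2 ⟨(hF _ h6).1, ?_⟩⟩, h4⟩
    · exact congrArg Prod.fst h2
    · exact congrArg Prod.snd h2
  · rw [Finset.card_product, nsmul_eq_mul, sq]
    push_cast; exact le_rfl

end Families

section Correlation

variable {Ω : Type*} [MeasurableSpace Ω] {P : Measure Ω} [IsProbabilityMeasure P]
  {A : Ω → Set ℕ}

lemma exp_le_measure_avoidsEvent (hm : ∀ n, MeasurableSet {ω | n ∈ A ω})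
    (hi : iIndepSet (fun n : ℕ => {ω | n ∈ A ω}) P) {F : Finset (Finset ℕ)} {q : ℝ}
    (hq : q ≤ 1 / 2) (hFq : ∀ S ∈ F, ∏ i ∈ S, P.real {ω | i ∈ A ω} ≤ q) :
    Real.exp (-((1 + 2 * q) * ∑ S ∈ F, ∏ i ∈ S, P.real {ω | i ∈ A ω})) ≤
      P.real (avoidsEvent A F) := by
  refine le_trans ?_ (prod_le_measure_avoidsEvent hm hi F)
  rw [Finset.mul_sum, ← Finset.sum_neg_distrib, Real.exp_sum]
  exact Finset.prod_le_prod (fun _ _ => (Real.exp_pos _).le) fun S hS =>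
    exp_neg_mul_le_one_sub (Finset.prod_nonneg fun _ _ => measureReal_nonneg) (hFq S hS) hq

/-- Janson's upper bound for `F ∪ G` is compared with the lower bounds for `F` and `G` separately.
As `F` and `G` are disjoint the main terms cancel, leaving `2q` times the two total weights, plus
`D`. -/
lemma measure_avoidsEvent_inter_le (hm : ∀ n, MeasurableSet {ω | n ∈ A ω})
    (hi : iIndepSet (fun n : ℕ => {ω | n ∈ A ω}) P) {F G : Finset (Finset ℕ)} {q μ D : ℝ}
    (hq0 : 0 ≤ q) (hq : q ≤ 1 / 2) (hFG : Disjoint F G)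
    (hFq : ∀ S ∈ F, ∏ i ∈ S, P.real {ω | i ∈ A ω} ≤ q)
    (hGq : ∀ S ∈ G, ∏ i ∈ S, P.real {ω | i ∈ A ω} ≤ q)
    (hFμ : ∑ S ∈ F, ∏ i ∈ S, P.real {ω | i ∈ A ω} ≤ μ)
    (hGμ : ∑ S ∈ G, ∏ i ∈ S, P.real {ω | i ∈ A ω} ≤ μ)
    (hD : ∑ q ∈ ((F ∪ G) ×ˢ (F ∪ G)).filter (fun q => q.1 ≠ q.2 ∧ ¬ Disjoint q.1 q.2),
      ∏ i ∈ q.1 ∪ q.2, P.real {ω | i ∈ A ω} ≤ D) :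
    P.real (avoidsEvent A F ∩ avoidsEvent A G) ≤
      P.real (avoidsEvent A F) * P.real (avoidsEvent A G) * Real.exp (4 * q * μ + D) := by
  have hF := exp_le_measure_avoidsEvent hm hi hq hFq
  have hG := exp_le_measure_avoidsEvent hm hi hq hGq
  have hJ := measure_avoidsEvent_le_exp hm hi (F ∪ G)
  rw [avoidsEvent_union, Finset.sum_union hFG] at hJ
  refine hJ.trans ?_
  refine le_trans ?_ (mul_le_mul_of_nonneg_right
    (mul_le_mul hF hG (Real.exp_pos _).le measureReal_nonneg) (Real.exp_pos _).le)
  rw [← Real.exp_add, ← Real.exp_add]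
  refine Real.exp_le_exp.2 ?_
  have h1 := mul_le_mul_of_nonneg_left hFμ hq0
  have h2 := mul_le_mul_of_nonneg_left hGμ hq0
  linarith

end Correlation

/-! ### Asymptotics of the error terms. -/

section Asymptotics

open Topology

lemma isLittleO_const_mul_log_add_one (c : ℝ) {r : ℝ} (hr : 0 < r) :
    (fun x : ℝ => c * Real.log x + 1) =o[atTop] fun x => x ^ r := by
  refine ((isLittleO_log_rpow_atTop hr).const_mul_left c).add ?_
  rw [Asymptotics.isLittleO_const_left]
  right
  exact tendsto_norm_atTop_atTop.comp (tendsto_rpow_atTop hr)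

lemma tendsto_log_mul_rpow_neg (c : ℝ) {τ : ℝ} (hτ : 0 < τ) :
    Tendsto (fun x : ℝ => (c * Real.log x + 1) * x ^ (-τ)) atTop (𝓝 0) := by
  refine (isLittleO_const_mul_log_add_one c hτ).tendsto_div_nhds_zero.congr' ?_
  filter_upwards [eventually_gt_atTop 0] with x hx
  rw [Real.rpow_neg hx.le, div_eq_mul_inv]

lemma tendsto_log_sq_mul_rpow_neg (c : ℝ) {τ : ℝ} (hτ : 0 < τ) :
    Tendsto (fun x : ℝ => (c * Real.log x + 1) ^ 2 * x ^ (-τ)) atTop (𝓝 0) := by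
  have h := (tendsto_log_mul_rpow_neg c (half_pos hτ)).pow 2
  rw [zero_pow two_ne_zero] at h
  refine h.congr' ?_
  filter_upwards [eventually_gt_atTop 0] with x hx
  rw [mul_pow, ← Real.rpow_mul_natCast hx.le]
  norm_num

lemma rpow_div_rpow_neg {x a κ σ : ℝ} (hx : 0 < x) (hκ : 0 < κ) :
    (x ^ a / κ) ^ (-σ) = κ ^ σ * x ^ (-(a * σ)) := by
  rw [Real.div_rpow (by positivity) hκ.le, ← Real.rpow_mul hx.le, Real.rpow_neg hκ.le, div_inv_eq_mul,
    mul_comm, mul_neg]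

/-- This is the overlap bound with `t = x ^ (σ/4)` and `L = x ^ (1/2)`: the factor `t` loses only
half of the saving `L ^ (-σ) = x ^ (-σ/2)`, so a negative power remains to beat the logarithms. -/
lemma tendsto_log_sq_mul_overlap_bound (c K κ σ : ℝ) (hκ : 0 < κ) (hσ : 0 < σ) :
    Tendsto (fun x : ℝ => (c * Real.log x + 1) ^ 2 * (K * ((x ^ (σ / 4) / κ) ^ (-σ) +
      (x ^ (σ / 4) + 1) * (x ^ (1 / 2 : ℝ) / 2 / κ) ^ (-σ)))) atTop (𝓝 0) := by
  have h1 := (tendsto_log_sq_mul_rpow_neg c (τ := σ / 4 * σ) (by positivity)).const_mul (K * κ ^ σ)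
  have h2 := (tendsto_log_sq_mul_rpow_neg c (τ := σ / 4) (by positivity)).const_mul
    (K * (2 * κ) ^ σ)
  have h3 := (tendsto_log_sq_mul_rpow_neg c (τ := 1 / 2 * σ) (by positivity)).const_mul
    (K * (2 * κ) ^ σ)
  have h := (h1.add h2).add h3
  rw [mul_zero, mul_zero, add_zero, add_zero] at h
  refine h.congr' ?_
  filter_upwards [eventually_gt_atTop 0] with x hx
  rw [div_div, rpow_div_rpow_neg hx hκ, rpow_div_rpow_neg hx (by positivity)]
  have : x ^ (-(σ / 4)) = x ^ (σ / 4) * x ^ (-(1 / 2 * σ)) := by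
    rw [← Real.rpow_add hx]; congr 1; ring
  rw [this]; ring

lemma tendsto_log_mul_rpow_div_rpow_neg (c κ : ℝ) {σ : ℝ} (hκ : 0 < κ) (hσ : 0 < σ) :
    Tendsto (fun x : ℝ => (c * Real.log x + 1) * (x ^ (1 / 2 : ℝ) / κ) ^ (-σ)) atTop (𝓝 0) := by
  have h := (tendsto_log_mul_rpow_neg c (τ := 1 / 2 * σ) (by positivity)).const_mul (κ ^ σ)
  rw [mul_zero] at h
  refine h.congr' ?_
  filter_upwards [eventually_gt_atTop 0] with x hx
  rw [rpow_div_rpow_neg hx hκ]; ring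

lemma tendsto_rpow_div_rpow_neg {κ σ : ℝ} (hκ : 0 < κ) (hσ : 0 < σ) :
    Tendsto (fun x : ℝ => (x ^ (1 / 2 : ℝ) / κ) ^ (-σ)) atTop (𝓝 0) := by
  have h := tendsto_log_mul_rpow_div_rpow_neg 0 κ hκ hσ
  simpa using h

lemma eventually_rpow_le_rpow_half_div_two {σ : ℝ} (hσ : σ ≤ 1) :
    ∀ᶠ x : ℝ in atTop, x ^ (σ / 4) ≤ x ^ (1 / 2 : ℝ) / 2 := by
  have h := tendsto_rpow_neg_atTop (y := 1 / 2 - σ / 4) (by linarith)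
  filter_upwards [h.eventually_le_const (show (0 : ℝ) < 1 / 2 by norm_num),
    eventually_gt_atTop 0] with x hx hx0
  have h1 : x ^ (σ / 4) = x ^ (-(1 / 2 - σ / 4)) * x ^ (1 / 2 : ℝ) := by
    rw [← Real.rpow_add hx0]; congr 1; ring
  rw [h1]
  nlinarith [Real.rpow_pos_of_pos hx0 (1 / 2)]

lemma eventually_half_le_sub_log_mul_rpow_half (c M : ℝ) :
    ∀ᶠ x : ℝ in atTop,
      x / 2 ≤ x - M - (c * Real.log x + 1) * (x ^ (1 / 2 : ℝ) + 1) := by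
  have h1 := tendsto_log_mul_rpow_neg c (τ := 1 / 2) (by norm_num)
  have h2 := tendsto_log_mul_rpow_neg c (τ := 1) (by norm_num)
  have h3 := (tendsto_rpow_neg_atTop (y := 1) (by norm_num)).const_mul M
  have h := (h1.add h2).add h3
  rw [mul_zero, add_zero, add_zero] at h
  filter_upwards [h.eventually_le_const (show (0 : ℝ) < 1 / 2 by norm_num),
    eventually_gt_atTop 0] with x hx hx0
  have e1 : x ^ (-(1 / 2) : ℝ) * x = x ^ (1 / 2 : ℝ) := by
    rw [← Real.rpow_add_one hx0.ne']; congr 1; norm_num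
  have e2 : x ^ (-1 : ℝ) * x = 1 := by
    rw [← Real.rpow_add_one hx0.ne']; norm_num
  have h4 := mul_le_mul_of_nonneg_right hx hx0.le
  have h5 : ((c * Real.log x + 1) * x ^ (-(1 / 2) : ℝ) + (c * Real.log x + 1) * x ^ (-1 : ℝ) +
      M * x ^ (-1 : ℝ)) * x = (c * Real.log x + 1) * (x ^ (1 / 2 : ℝ) + 1) + M := by
    linear_combination (c * Real.log x + 1) * e1 + ((c * Real.log x + 1) + M) * e2
  rw [h5] at h4
  linarith

/-- The error term of the second moment method tends to zero. -/
lemma tendsto_log_sq_div {c l κ σ M : ℝ} (hcl : c * l < 1)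
    (hκ : 0 < κ) (hσ : 0 < σ) :
    Tendsto (fun x : ℝ => (c * Real.log x + 1) ^ 2 /
      ((x - M - (c * Real.log x + 1) * (x ^ (1 / 2 : ℝ) + 1)) *
        Real.exp (-((1 + 2 * (x ^ (1 / 2 : ℝ) / κ) ^ (-σ)) * ((c * Real.log x + 1) * l)))))
      atTop (𝓝 0) := by
  have h1 := (tendsto_log_sq_mul_rpow_neg c (τ := 1 - c * l) (by linarith)).const_mul
    (2 * Real.exp (1 + l))
  rw [mul_zero] at h1
  have h2 := (tendsto_log_mul_rpow_div_rpow_neg c κ hκ hσ).const_mul (2 * l)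
  rw [mul_zero] at h2
  refine tendsto_of_tendsto_of_tendsto_of_le_of_le' tendsto_const_nhds h1 ?_ ?_
  · filter_upwards [eventually_half_le_sub_log_mul_rpow_half c M, eventually_gt_atTop 0]
      with x hx hx0
    have : 0 ≤ x - M - (c * Real.log x + 1) * (x ^ (1 / 2 : ℝ) + 1) := by linarith
    positivity
  · filter_upwards [eventually_half_le_sub_log_mul_rpow_half c M, eventually_gt_atTop 0,
      h2.eventually_le_const zero_lt_one] with x hx hx0 hx1
    set ℓ := c * Real.log x + 1 with hℓ
    -- For large `x` the part of the exponent coming from `2q` is at most 1 and `ℓ * l = c * l * log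
    -- x + l`, so the error is `O(log² x · x ^ (c l - 1))`.
    have h3 : Real.exp (-(1 + l)) * x ^ (-(c * l)) ≤
        Real.exp (-((1 + 2 * (x ^ (1 / 2 : ℝ) / κ) ^ (-σ)) * (ℓ * l))) := by
      rw [Real.rpow_def_of_pos hx0, ← Real.exp_add]
      refine Real.exp_le_exp.2 ?_
      have : ℓ * l = c * l * Real.log x + l := by rw [hℓ]; ring
      nlinarith
    have h4 := (half_pos hx0).le.trans hx
    calc _ ≤ ℓ ^ 2 / (x / 2 * (Real.exp (-(1 + l)) * x ^ (-(c * l)))) :=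
        (by gcongr)
      _ = _ := by
        rw [Real.exp_neg, neg_sub, sub_eq_add_neg (c * l) 1, Real.rpow_add hx0,
          Real.rpow_neg hx0.le, Real.rpow_neg_one]
        field_simp

end Asymptotics

/-! ### The representing families of an integer, and the integers far above `B`. -/

open Classical in
/-- The elements of `B` up to `N`. -/
noncomputable def initialPart (B : Set ℕ) (N : ℕ) : Finset ℕ :=
  (Finset.range (N + 1)).filter (· ∈ B)

open Classical in
/-- The `s`-sets `S` such that `n` is the sum of `S` plus an element of `B`. -/
noncomputable def repFamily (s : ℕ) (B : Set ℕ) (n : ℕ) : Finset (Finset ℕ) :=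
  ((Finset.range (n + 1)).powersetCard s).filter fun S => ∃ b ∈ B, n = ∑ i ∈ S, i + b

/-- The values `n - b`, where `b ∈ B` is at most `n`. -/
noncomputable def differences (B : Set ℕ) (N n : ℕ) : Finset ℕ :=
  ((initialPart B N).filter (· ≤ n)).image (n - ·)

lemma mem_initialPart {B : Set ℕ} {N b : ℕ} : b ∈ initialPart B N ↔ b ≤ N ∧ b ∈ B := by
  classical
  rw [initialPart, Finset.mem_filter, Finset.mem_range, Nat.lt_succ_iff]

/-- The extra 1 allows for `0 ∈ B`, which `countFn` ignores. -/
lemma card_initialPart_le (B : Set ℕ) (N : ℕ) : (initialPart B N).card ≤ countFn B N + 1 := by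
  have hfin : (B ∩ Set.Icc 1 N).Finite := (Set.finite_Icc 1 N).inter_of_right B
  rw [← Set.ncard_coe_finset, countFn]
  refine (Set.ncard_le_ncard (t := insert 0 (B ∩ Set.Icc 1 N)) (fun b hb => ?_)
    (hfin.insert 0)).trans (Set.ncard_insert_le _ _)
  obtain ⟨h1, h2⟩ := mem_initialPart.1 (Finset.mem_coe.1 hb)
  rcases Nat.eq_zero_or_pos b with rfl | h
  · exact Set.mem_insert _ _
  · exact Set.mem_insert_of_mem _ ⟨h2, h, h1⟩

lemma card_differences_le (B : Set ℕ) (N n : ℕ) :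
    (differences B N n).card ≤ (initialPart B N).card :=
  Finset.card_image_le.trans (Finset.card_filter_le _ _)

lemma exists_of_mem_repFamily {s : ℕ} {B : Set ℕ} {n N : ℕ} (hn : n ≤ N) {S : Finset ℕ}
    (hS : S ∈ repFamily s B n) :
    S.card = s ∧ ∃ b ∈ initialPart B N, n = ∑ i ∈ S, i + b := by
  classical
  obtain ⟨h1, b, hb, h2⟩ := Finset.mem_filter.1 hS
  exact ⟨(Finset.mem_powersetCard.1 h1).2, b, mem_initialPart.2 ⟨by omega, hb⟩, h2⟩

lemma sum_mem_differences {s : ℕ} {B : Set ℕ} {n N : ℕ} (hn : n ≤ N) {S : Finset ℕ}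
    (hS : S ∈ repFamily s B n) : S.card = s ∧ ∑ i ∈ S, i ∈ differences B N n := by
  obtain ⟨h1, b, hb, h2⟩ := exists_of_mem_repFamily hn hS
  exact ⟨h1, Finset.mem_image.2 ⟨b, Finset.mem_filter.2 ⟨hb, by omega⟩, by omega⟩⟩

lemma avoidsEvent_repFamily_subset {Ω : Type*} (A : Ω → Set ℕ) (s : ℕ) (B : Set ℕ) (n : ℕ) :
    avoidsEvent A (repFamily s B n) ⊆ {ω | ¬ IsDistinctSumAdd s (A ω) B n} := by
  classical
  rintro ω hω ⟨a, hinj, haA, b, hb, hn⟩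
  have hsum : ∑ i ∈ Finset.univ.map ⟨a, hinj⟩, i = ∑ i, a i := by simp
  refine hω (Finset.univ.map ⟨a, hinj⟩) ?_ ?_
  · refine Finset.mem_filter.2 ⟨Finset.mem_powersetCard.2 ⟨fun i hi => ?_, by simp⟩,
      b, hb, by rw [hsum]; exact hn⟩
    have := Finset.single_le_sum (f := fun i : ℕ => i) (fun _ _ => Nat.zero_le _) hi
    rw [hsum] at this
    rw [Finset.mem_range]
    omega
  · intro i hi
    obtain ⟨k, -, rfl⟩ := Finset.mem_map.1 hi
    exact haA k

lemma IsPseudoPowers.measureReal_mem {Ω : Type*} [MeasurableSpace Ω] {P : Measure Ω} {s : ℕ}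
    {A : Ω → Set ℕ} (hA : IsPseudoPowers P s A) (hs : 2 ≤ s) (n : ℕ) :
    P.real {ω | n ∈ A ω} = powerDensity s n := by
  rcases Nat.eq_zero_or_pos n with rfl | hn
  · rw [powerDensity_zero hs]
    have : {ω | 0 ∈ A ω} = ∅ := Set.eq_empty_of_forall_notMem hA.zero_notMem
    rw [this, measureReal_empty]
  · rw [measureReal_def, hA.prob n hn]
    exact ENNReal.toReal_ofReal (powerDensity_nonneg s n)

/-- The integers in `(M, N]` which are at distance at least `L` above every smaller element
of `B`. -/
noncomputable def farPoints (B : Set ℕ) (L : ℝ) (M N : ℕ) : Finset ℕ :=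
  open Classical in
  (Finset.Ioc M N).filter fun n => ∀ b ∈ initialPart B N, b ≤ n → L ≤ ((n - b : ℕ) : ℝ)

/-- Each `b` rules out at most `⌈L⌉` integers, those in `[b, b + ⌈L⌉)`. -/
lemma le_card_farPoints (B : Set ℕ) {L : ℝ} (hL : 0 ≤ L) (M N : ℕ) :
    (N : ℝ) - M - (initialPart B N).card * (L + 1) ≤ (farPoints B L M N).card := by
  classical
  have h1 : Finset.Ioc M N ⊆ farPoints B L M N ∪
      (initialPart B N).biUnion fun b => Finset.Ico b (b + ⌈L⌉₊) := by
    intro n hn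
    by_cases h : n ∈ farPoints B L M N
    · exact Finset.mem_union_left _ h
    · have h' : ∃ b ∈ initialPart B N, b ≤ n ∧ ((n - b : ℕ) : ℝ) < L := by
        by_contra hcon
        push Not at hcon
        exact h (Finset.mem_filter.2 ⟨hn, hcon⟩)
      obtain ⟨b, hb, hbn, hbL⟩ := h'
      have := Nat.lt_ceil.2 hbL
      exact Finset.mem_union_right _ (Finset.mem_biUnion.2
        ⟨b, hb, Finset.mem_Ico.2 ⟨hbn, by omega⟩⟩)
  have h2 := (Finset.card_le_card h1).trans (Finset.card_union_le _ _)
  have h3 : ((initialPart B N).biUnion fun b => Finset.Ico b (b + ⌈L⌉₊)).card ≤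
      (initialPart B N).card * ⌈L⌉₊ :=
    Finset.card_biUnion_le_card_mul _ _ _ fun b _ => by simp
  rw [Nat.card_Ioc] at h2
  have h4 : N ≤ M + ((farPoints B L M N).card + (initialPart B N).card * ⌈L⌉₊) := by omega
  have h5 : (N : ℝ) ≤ M + ((farPoints B L M N).card + (initialPart B N).card * ⌈L⌉₊) := by
    exact_mod_cast h4
  have h6 : ((initialPart B N).card : ℝ) * ⌈L⌉₊ ≤ (initialPart B N).card * (L + 1) :=
    mul_le_mul_of_nonneg_left (Nat.ceil_lt_add_one hL).le (Nat.cast_nonneg _)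
  linarith

lemma lambdaConst_pos {s : ℕ} (hs : 2 ≤ s) : 0 < lambdaConst s := by
  have : 0 < Real.Gamma (1 / (s : ℝ)) := Real.Gamma_pos_of_pos (by positivity)
  unfold lambdaConst
  positivity

/-! ### Assembling the bounds and letting `N` grow. -/

section

variable {Ω : Type*} [MeasurableSpace Ω] {P : Measure Ω} [IsProbabilityMeasure P]
  {s : ℕ} {A : Ω → Set ℕ}

/-- An explicit bound for the probability that all integers above `M` are represented. -/
lemma measure_forall_isDistinctSumAdd_le (hs : 2 ≤ s) (hA : IsPseudoPowers P s A) (B : Set ℕ)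
    {M N : ℕ} {ℓ L t q D : ℝ} (hℓ : ((initialPart B N).card : ℝ) ≤ ℓ) (hL : 0 < L) (ht : 0 < t)
    (htL : t ≤ L / 2) (hq : (L / s) ^ (-(1 / (s : ℝ))) = q) (hq2 : q ≤ 1 / 2)
    (hD : s * (max 1 (Real.Gamma (1 / (s : ℝ)) / s) ^ s) ^ 3 *
      ((t / s) ^ (-(1 / (s : ℝ))) + (t + 1) * (L / 2 / s) ^ (-(1 / (s : ℝ)))) = D)
    (hpos : 0 < N - M - ℓ * (L + 1)) :
    P.real {ω | ∀ n, M < n → IsDistinctSumAdd s (A ω) B n} ≤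
      Real.exp (4 * q * (ℓ * lambdaConst s) + (2 * ℓ) ^ 2 * D) - 1 +
        ℓ ^ 2 / ((N - M - ℓ * (L + 1)) *
          Real.exp (-((1 + 2 * q) * (ℓ * lambdaConst s)))) := by
  classical
  have hw : ∀ S : Finset ℕ, ∏ i ∈ S, P.real {ω | i ∈ A ω} = ∏ i ∈ S, powerDensity s i :=
    fun S => Finset.prod_congr rfl fun i _ => hA.measureReal_mem hs i
  have hf := powerDensity_nonneg s
  have hm := hA.measurableSet_mem
  have hi := hA.indep
  have hlam := (lambdaConst_pos hs).le
  have hq0 : 0 ≤ q := by rw [← hq]; positivity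
  have hD0 : 0 ≤ D := by rw [← hD]; positivity
  have hℓ0 : 0 ≤ ℓ := (Nat.cast_nonneg _).trans hℓ
  set G := farPoints B L M N with hG
  have hGN : ∀ n ∈ G, n ≤ N := fun n hn => (Finset.mem_Ioc.1 (Finset.mem_filter.1 hn).1).2
  have hGM : ∀ n ∈ G, M < n := fun n hn => (Finset.mem_Ioc.1 (Finset.mem_filter.1 hn).1).1
  have hGL : ∀ n ∈ G, ∀ x ∈ differences B N n, L ≤ (x : ℝ) := by
    intro n hn x hx
    obtain ⟨b, hb, rfl⟩ := Finset.mem_image.1 hx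
    obtain ⟨hb, hbn⟩ := Finset.mem_filter.1 hb
    exact (Finset.mem_filter.1 hn).2 b hb hbn
  have hGcard : N - M - ℓ * (L + 1) ≤ (G.card : ℝ) := by
    have := le_card_farPoints B hL.le M N
    nlinarith
  have hXcard : ∀ n, ((differences B N n).card : ℝ) ≤ ℓ := fun n =>
    le_trans (by exact_mod_cast card_differences_le B N n) hℓ
  have hFq : ∀ n ∈ G, ∀ S ∈ repFamily s B n, ∏ i ∈ S, P.real {ω | i ∈ A ω} ≤ q := by
    intro n hn S hS
    obtain ⟨h1, h2⟩ := sum_mem_differences (hGN n hn) hS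
    rw [hw, ← hq]
    exact prod_powerDensity_le hs h1 hL (hGL n hn _ h2)
  have hFμ : ∀ n ∈ G, ∑ S ∈ repFamily s B n, ∏ i ∈ S, P.real {ω | i ∈ A ω} ≤
      ℓ * lambdaConst s := by
    intro n hn
    simp only [hw]
    exact (sum_prod_le_card_mul hf (fun S hS => sum_mem_differences (hGN n hn) hS)
      (repSum_powerDensity_le_lambdaConst hs)).trans
      (mul_le_mul_of_nonneg_right (hXcard n) hlam)
  have hlow : ∀ n ∈ G, Real.exp (-((1 + 2 * q) * (ℓ * lambdaConst s))) ≤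
      P.real (avoidsEvent A (repFamily s B n)) := by
    intro n hn
    refine le_trans (Real.exp_le_exp.2 (neg_le_neg ?_))
      (exp_le_measure_avoidsEvent hm hi hq2 (hFq n hn))
    exact mul_le_mul_of_nonneg_left (hFμ n hn) (by linarith)
  have hcorr : ∀ n ∈ G, ∀ m ∈ G,
      ¬ (∃ b ∈ initialPart B N, ∃ b' ∈ initialPart B N, n + b' = m + b) →
      P.real (avoidsEvent A (repFamily s B n) ∩ avoidsEvent A (repFamily s B m)) ≤
        P.real (avoidsEvent A (repFamily s B n)) * P.real (avoidsEvent A (repFamily s B m)) *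
          Real.exp (4 * q * (ℓ * lambdaConst s) + (2 * ℓ) ^ 2 * D) := by
    intro n hn m hm' hnm
    refine measure_avoidsEvent_inter_le hm hi hq0 hq2 ?_ (hFq n hn) (hFq m hm') (hFμ n hn)
      (hFμ m hm') ?_
    -- A set `S` representing both `n` and `m` would give `n - b = ∑ S = m - b'`, the excluded
    -- relation.
    · rw [Finset.disjoint_left]
      intro S hS hS'
      obtain ⟨-, b, hb, h1⟩ := exists_of_mem_repFamily (hGN n hn) hS
      obtain ⟨-, b', hb', h2⟩ := exists_of_mem_repFamily (hGN m hm') hS'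
      exact hnm ⟨b, hb, b', hb', by omega⟩
    · simp only [hw]
      -- The sums of sets in either family lie in a set of at most `2ℓ` integers, all at least `L`;
      -- hence the factor `(2ℓ)²`.
      refine (sum_overlap_le_card_sq_mul (s := s) (X := differences B N n ∪ differences B N m)
        (D := D) hf ?_ ?_).trans ?_
      · intro S hS
        rcases Finset.mem_union.1 hS with hS | hS
        · obtain ⟨h1, h2⟩ := sum_mem_differences (hGN n hn) hS
          exact ⟨h1, Finset.mem_union_left _ h2⟩
        · obtain ⟨h1, h2⟩ := sum_mem_differences (hGN m hm') hS
          exact ⟨h1, Finset.mem_union_right _ h2⟩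
      · intro x _ y hy
        rw [← hD]
        refine overlapSum_powerDensity_le hs hL ht htL ?_
        rcases Finset.mem_union.1 hy with hy | hy
        exacts [hGL n hn y hy, hGL m hm' y hy]
      · refine mul_le_mul_of_nonneg_right (pow_le_pow_left₀ (Nat.cast_nonneg _) ?_ 2) hD0
        have h1 : ((differences B N n ∪ differences B N m).card : ℝ) ≤
            (differences B N n).card + (differences B N m).card := by
          exact_mod_cast Finset.card_union_le _ _
        linarith [hXcard n, hXcard m]
  -- For fixed `n`, a related `m` is determined by the pair `(b, b')`.
  have hR : ∀ n ∈ G, ((G.filter fun m =>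
      ∃ b ∈ initialPart B N, ∃ b' ∈ initialPart B N, n + b' = m + b).card : ℝ) ≤ ℓ ^ 2 := by
    intro n _
    have h1 : (G.filter fun m =>
        ∃ b ∈ initialPart B N, ∃ b' ∈ initialPart B N, n + b' = m + b) ⊆
        (initialPart B N ×ˢ initialPart B N).image fun z => n + z.2 - z.1 := by
      intro m hm'
      obtain ⟨-, b, hb, b', hb', h⟩ := Finset.mem_filter.1 hm'
      exact Finset.mem_image.2 ⟨(b, b'), Finset.mem_product.2 ⟨hb, hb'⟩, by dsimp only; omega⟩
    have h2 := (Finset.card_le_card h1).trans Finset.card_image_le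
    rw [Finset.card_product] at h2
    calc _ ≤ ((initialPart B N).card : ℝ) * (initialPart B N).card := by exact_mod_cast h2
      _ ≤ ℓ ^ 2 := by rw [sq]; gcongr
  have hGne : G.Nonempty := by
    rw [← Finset.card_pos]
    have : (0 : ℝ) < G.card := hpos.trans_le hGcard
    exact_mod_cast this
  have hmain := measure_compl_biUnion_le (P := P) (G := G)
    (E := fun n => avoidsEvent A (repFamily s B n)) (fun n => measurableSet_avoidsEvent hm _)
    (fun n m => ∃ b ∈ initialPart B N, ∃ b' ∈ initialPart B N, n + b' = m + b)
    hGne (Real.exp_pos _) hlow hR hcorr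
  have hsub : {ω | ∀ n, M < n → IsDistinctSumAdd s (A ω) B n} ⊆
      (⋃ n ∈ G, avoidsEvent A (repFamily s B n))ᶜ := by
    intro ω hω hmem
    obtain ⟨n, hn, hmem⟩ := Set.mem_iUnion₂.1 hmem
    exact avoidsEvent_repFamily_subset A s B n hmem (hω n (hGM n hn))
  refine (measureReal_mono hsub).trans (hmain.trans ?_)
  gcongr

open Topology in
/-- If `B` is sparse on infinitely many initial segments, almost surely some integer above `M`
is not represented. -/
lemma measure_forall_isDistinctSumAdd_eq_zero (hs : 2 ≤ s) (hA : IsPseudoPowers P s A)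
    {B : Set ℕ} {c : ℝ} (hc : c * lambdaConst s < 1)
    (hB : ∃ᶠ N : ℕ in atTop, (countFn B N : ℝ) ≤ c * Real.log N) (M : ℕ) :
    P.real {ω | ∀ n, M < n → IsDistinctSumAdd s (A ω) B n} = 0 := by
  have hs0 : (0 : ℝ) < s := by positivity
  have hσ : (0 : ℝ) < 1 / s := by positivity
  have hσ1 : (1 : ℝ) / s ≤ 1 := by
    rw [div_le_one hs0]; exact_mod_cast (by omega : 1 ≤ s)
  have hlam := (lambdaConst_pos hs).le
  refine le_antisymm (le_of_forall_pos_le_add fun ε hε => ?_) measureReal_nonneg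
  rw [zero_add]
  have h1 := (tendsto_log_mul_rpow_div_rpow_neg c s hs0 hσ).const_mul (4 * lambdaConst s)
  have h2 := (tendsto_log_sq_mul_overlap_bound c
    (s * (max 1 (Real.Gamma (1 / (s : ℝ)) / s) ^ s) ^ 3) s (1 / s) hs0 hσ).const_mul 4
  have h3 := ((Real.continuous_exp.tendsto _).comp (h1.add h2)).sub_const 1
  have h4 := h3.add (tendsto_log_sq_div (M := M) hc hs0 hσ)
  rw [mul_zero, mul_zero, add_zero, add_zero, Real.exp_zero, sub_self] at h4
  have hev := tendsto_natCast_atTop_atTop (R := ℝ) |>.eventually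
    ((h4.eventually_le_const hε).and
      (((tendsto_rpow_div_rpow_neg hs0 hσ).eventually_le_const
        (show (0 : ℝ) < 1 / 2 by norm_num)).and
      ((eventually_rpow_le_rpow_half_div_two hσ1).and
      ((eventually_half_le_sub_log_mul_rpow_half c M).and (eventually_gt_atTop 0)))))
  -- The bound tends to 0 along all `N`, so a single large `N` at which `B` is sparse suffices for
  -- the given `ε`.
  obtain ⟨N, hBN, hε', hq, ht, hhalf, hN⟩ := (hB.and_eventually hev).exists
  refine le_trans (measure_forall_isDistinctSumAdd_le hs hA B (N := N)
    (ℓ := c * Real.log N + 1) (L := (N : ℝ) ^ (1 / 2 : ℝ)) (t := (N : ℝ) ^ (1 / (s : ℝ) / 4))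
    ?_ (by positivity) (by positivity) ht rfl hq rfl (by linarith)) ?_
  · have : ((initialPart B N).card : ℝ) ≤ countFn B N + 1 := by
      exact_mod_cast card_initialPart_le B N
    linarith
  · refine le_trans (le_of_eq ?_) hε'
    simp only [Function.comp_apply]
    congr 3
    ring

end

theorem theorem3 {Ω : Type*} [MeasurableSpace Ω] (P : Measure Ω) [IsProbabilityMeasure P]
    (s : ℕ) (hs : 2 ≤ s) (A : Ω → Set ℕ) (hA : IsPseudoPowers P s A) (B : Set ℕ)
    (hB : liminf (fun n : ℕ => (((countFn B n : ℝ) / Real.log (n : ℝ) : ℝ) : EReal)) atTop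
      < (((lambdaConst s)⁻¹ : ℝ) : EReal)) :
    ∀ᵐ ω ∂P, {n : ℕ | ¬ IsDistinctSumAdd s (A ω) B n}.Infinite := by
  have hlam := lambdaConst_pos hs
  -- The gap between `c` and `1 / λ_s` is what makes the exponent `c λ_s - 1` negative.
  obtain ⟨c, hc1, hc2⟩ := EReal.exists_rat_btwn_of_lt hB
  have hc2' : (c : ℝ) < (lambdaConst s)⁻¹ := EReal.coe_lt_coe_iff.1 hc2
  have hfreq := frequently_lt_of_liminf_lt (by isBoundedDefault) hc1
  have hBf : ∃ᶠ N : ℕ in atTop, (countFn B N : ℝ) ≤ max (c : ℝ) 0 * Real.log N := by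
    refine (hfreq.and_eventually (eventually_ge_atTop 2)).mono ?_
    rintro N ⟨h, hN⟩
    have hlog : 0 < Real.log N := Real.log_pos (by exact_mod_cast hN)
    have h' : (countFn B N : ℝ) / Real.log N < c := EReal.coe_lt_coe_iff.1 h
    rw [div_lt_iff₀ hlog] at h'
    exact h'.le.trans (mul_le_mul_of_nonneg_right (le_max_left _ _) hlog.le)
  have hcl : max (c : ℝ) 0 * lambdaConst s < 1 := by
    rw [← lt_div_iff₀ hlam, one_div]
    exact max_lt hc2' (inv_pos.2 hlam)
  -- A finite set of unrepresented integers is bounded by some `M`, so countably many null events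
  -- cover the failure.
  have h0 : ∀ M : ℕ, ∀ᵐ ω ∂P, ¬ ∀ n, M < n → IsDistinctSumAdd s (A ω) B n := by
    intro M
    have := measure_forall_isDistinctSumAdd_eq_zero hs hA hcl hBf M
    rw [measureReal_eq_zero_iff] at this
    rw [ae_iff]
    simpa only [not_not] using this
  filter_upwards [ae_all_iff.2 h0] with ω hω hfin
  obtain ⟨M, hM⟩ := hfin.bddAbove
  refine hω M fun n hn => ?_
  by_contra hcon
  exact absurd (hM hcon) (not_le.2 hn)
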